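/- Let $n\ge 0$, let $R=\mathbb{Z}[x]$ with $x$ an indeterminate, and let $\mathcal{A}_n(x)$ be the Temperley--Lieb algebra: the unital associative $R$-algebra generated by $e_1,\dots,e_{n-1}$ with relations $e_i^2=xe_i$, $e_ie_{i\pm1}e_i=e_i$, and $e_ie_j=e_je_i$ for $|i-j|\ge2$. For $k\le n$ regard $\mathcal{A}_k(x)$ as the subalgebra of $\mathcal{A}_n(x)$ generated by $e_1,\dots,e_{k-1}$. **Partitions and paths.** A partition of $n$ is a pair $\lambda=(f,n-2f)$ with $0\le 2f\le n$; write $(f,n-2f)\unrhd(g,n-2g)$ if $f\ge g$, and $\rhd$ for $\unrhd$ and $\ne$. If $\mu$ is a partition of $n-1$ and $\lambda=(f,n-2f)$, write $\mu\to\lambda$ if $\mu=(f,n-2f-1)$ or $\mu=(f-1,n-2f+1)$. Let $\mathfrak{T}_n(\lambda)$ be the set of sequences $\mathfrak{t}=(\lambda^{(0)},\dots,\lambda^{(n)})$, with $\lambda^{(k)}$ a partition of $k$, such that $\lambda^{(0)}=(0,0)$, $\lambda^{(k-1)}\to\lambda^{(k)}$ for $1\le k\le n$, and $\lambda^{(n)}=\lambda$.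 Put $\mathfrak{t}|_k=(\lambda^{(0)},\dots,\lambda^{(k)})$ and $\mathrm{SHAPE}(\mathfrak{t}|_k)=\lambda^{(k)}$. Write $\mathfrak{s}\unrhd\mathfrak{t}$ if $\mathrm{SHAPE}(\mathfrak{s}|_k)\unrhd\mathrm{SHAPE}(\mathfrak{t}|_k)$ for all $k$, and $\mathfrak{s}\rhd\mathfrak{t}$ if moreover $\mathfrak{s}\neq\mathfrak{t}$. **Cell modules.** For $\lambda=(f,n-2f)$ let $m_\lambda=e_1e_3\cdots e_{2f-1}$ (so $m_\lambda=1$ if $f=0$), let $\mathcal{A}_n^\lambda$ be the two-sided ideal generated by $m_\lambda$, and let $\check{\mathcal{A}}_n^\lambda=\sum_{\mu\rhd\lambda}\mathcal{A}_n^\mu$. Let $C^\lambda$ be the right $\mathcal{A}_n(x)$-submodule of $\mathcal{A}_n(x)/\check{\mathcal{A}}_n^\lambda$ generated by $m_{\mathfrak{t}^\lambda}=m_\lambda+\check{\mathcal{A}}_n^\lambda$. For $i\le j$ let $w_{i,j}=e_ie_{i+1}\cdots e_{j-1}$ (so $w_{i,i}=1$). Define $v_{\mathfrak{t}}$ recursively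 by $v_{((0,0))}=1$ and, for $\mathfrak{t}\in\mathfrak{T}_n(\lambda)$ with $n\ge1$, $\lambda=(f,n-2f)$ and $\mathfrak{s}=\mathfrak{t}|_{n-1}$, by $v_{\mathfrak{t}}=v_{\mathfrak{s}}$ if $\mathrm{SHAPE}(\mathfrak{s})=(f,n-2f-1)$, and $v_{\mathfrak{t}}=w_{2f,n}v_{\mathfrak{s}}$ if $\mathrm{SHAPE}(\mathfrak{s})=(f-1,n-2f+1)$. Put $m_{\mathfrak{t}}=m_{\mathfrak{t}^\lambda}v_{\mathfrak{t}}\in C^\lambda$. **Jucys--Murphy elements.** Let $T_0=T_1=0$, $T_2=e_1$, $z_i=\sum_{l=0}^{i}x^lT_{i-l}$ for $i\ge0$, and $$T_{i+1}=-e_iT_i-T_ie_i+e_ie_{i-1}T_ie_i-z_{i-1}-e_iz_{i-2}\qquad(i\ge2),$$ so that $T_k,z_k\in\mathcal{A}_n(x)$ for $k\le n$. Let $p_0=0$, $p_1=1$, $p_{i+1}=xp_i-p_{i-1}$ for $i\ge1$. For $\mathfrak{t}\in\mathfrak{T}_n(\lambda)$ let $r_{\mathfrak{t}}(0)=r_{\mathfrak{t}}(1)=0$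 and, for $2\le k\le n$ with $\mathrm{SHAPE}(\mathfrak{t}|_k)=(i,k-2i)$, $$r_{\mathfrak{t}}(k)=\begin{cases}(p_i-xp_{i-1})p_{k-i+1}&\text{if }\mathrm{SHAPE}(\mathfrak{t}|_{k-1})=(i-1,k-2i+1),\\(p_{k-i+1}-xp_{k-i})p_i&\text{if }\mathrm{SHAPE}(\mathfrak{t}|_{k-1})=(i,k-2i-1),\end{cases}$$ and let $z_{\mathfrak{t}}(k)=\sum_{l=0}^{k}x^lr_{\mathfrak{t}}(k-l)$ for $0\le k\le n$. **Statement.** Let $\lambda$ be a partition of $n$, $\mathfrak{t}\in\mathfrak{T}_n(\lambda)$ and $0\le k\le n$, and suppose that $\mathrm{SHAPE}(\mathfrak{t}|_k)=(i,k-2i)$. Then $z_k$ lies in $\mathcal{A}_k(x)$ and is central there, $z_{\mathfrak{t}}(k)=p_ip_{k-i+1}$, and there exist $a_{\mathfrak{s}}\in R$, for $\mathfrak{s}\in\mathfrak{T}_n(\lambda)$, such that in $C^\lambda$ $$m_{\mathfrak{t}}z_k=z_{\mathfrak{t}}(k)\,m_{\mathfrak{t}}+\sum_{\mathfrak{s}\rhd\mathfrak{t}}a_{\mathfrak{s}}m_{\mathfrak{s}}.$$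 -/

import Mathlib

noncomputable section

namespace TemperleyLieb

open Polynomial MulOpposite

/-- The indices `1, …, n - 1` of the generators. -/
abbrev Idx (n : ℕ) : Type := {i : ℕ // 1 ≤ i ∧ i < n}

/-- The defining relations of the Temperley–Lieb algebra. -/
inductive Rel (n : ℕ) : FreeAlgebra ℤ[X] (Idx n) → FreeAlgebra ℤ[X] (Idx n) → Prop
  | sq (i : Idx n) :
      Rel n (FreeAlgebra.ι ℤ[X] i * FreeAlgebra.ι ℤ[X] i) ((X : ℤ[X]) • FreeAlgebra.ι ℤ[X] i)
  | braid (i j : Idx n) (h : j.1 = i.1 + 1 ∨ i.1 = j.1 + 1) :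
      Rel n (FreeAlgebra.ι ℤ[X] i * FreeAlgebra.ι ℤ[X] j * FreeAlgebra.ι ℤ[X] i)
        (FreeAlgebra.ι ℤ[X] i)
  | comm (i j : Idx n) (h : i.1 + 2 ≤ j.1 ∨ j.1 + 2 ≤ i.1) :
      Rel n (FreeAlgebra.ι ℤ[X] i * FreeAlgebra.ι ℤ[X] j)
        (FreeAlgebra.ι ℤ[X] j * FreeAlgebra.ι ℤ[X] i)

/-- The Temperley–Lieb algebra `𝒜ₙ(x)` over `R = ℤ[x]`. -/
def TL (n : ℕ) : Type := RingQuot (Rel n)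

instance (n : ℕ) : Ring (TL n) := inferInstanceAs (Ring (RingQuot (Rel n)))

instance (n : ℕ) : Algebra ℤ[X] (TL n) := inferInstanceAs (Algebra ℤ[X] (RingQuot (Rel n)))

/-- The quotient map from the free algebra. -/
def TL.mk (n : ℕ) : FreeAlgebra ℤ[X] (Idx n) →ₐ[ℤ[X]] TL n := RingQuot.mkAlgHom ℤ[X] (Rel n)

/-- The generator `eᵢ` of `𝒜ₙ(x)`, for `1 ≤ i ≤ n - 1`; other indices, which never matter, give
`0`. -/
def e (n i : ℕ) : TL n :=
  if h : 1 ≤ i ∧ i < n then TL.mk n (FreeAlgebra.ι ℤ[X] ⟨i, h⟩) else 0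

/-- `𝒜ₖ(x)` inside `𝒜ₙ(x)`, for `k ≤ n`: the subalgebra generated by `e₁, …, eₖ₋₁`. -/
def tower (n k : ℕ) : Subalgebra ℤ[X] (TL n) :=
  Algebra.adjoin ℤ[X] {a | ∃ j, 1 ≤ j ∧ j < k ∧ a = e n j}

/-- A partition of `n`: a pair `(i, n - 2i)` with `0 ≤ 2i ≤ n`. -/
abbrev Par (n : ℕ) : Type := {p : ℕ × ℕ // 2 * p.1 + p.2 = n}

instance (n : ℕ) : Finite (Par n) :=
  Finite.of_injective (fun p : Par n => (⟨p.1.1, by have := p.2; omega⟩ : Fin (n + 1))) (by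
    rintro ⟨⟨a, b⟩, h⟩ ⟨⟨c, d⟩, h'⟩ hac
    simp only [Fin.mk.injEq] at hac
    simp only at h h'
    subst hac
    simp only [Subtype.mk.injEq, Prod.mk.injEq, true_and]
    omega)

/-- `lam ⊵ mu`. -/
def Par.Dom {n : ℕ} (lam mu : Par n) : Prop := mu.1.1 ≤ lam.1.1

/-- `lam ▷ mu`. -/
def Par.SDom {n : ℕ} (lam mu : Par n) : Prop := lam.Dom mu ∧ lam ≠ mu

/-- `mu → lam`: if `lam = (i, n + 1 - 2i)`, then `mu = (i, n - 2i)` or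
`mu = (i - 1, n + 2 - 2i)`. -/
def Par.Arrow {n : ℕ} (mu : Par n) (lam : Par (n + 1)) : Prop :=
  (mu.1.1 = lam.1.1 ∧ mu.1.2 + 1 = lam.1.2) ∨ (mu.1.1 + 1 = lam.1.1 ∧ mu.1.2 = lam.1.2 + 1)

/-- The set `𝔗ₙ(λ)` of sequences `(λ⁽⁰⁾, …, λ⁽ⁿ⁾)` of partitions with `λ⁽⁰⁾ = (0, 0)`,
`λ⁽ᵏ⁻¹⁾ → λ⁽ᵏ⁾` for `k = 1, …, n`, and `λ⁽ⁿ⁾ = λ`. -/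
def Tab {n : ℕ} (lam : Par n) : Type :=
  {s : (k : Fin (n + 1)) → Par k //
    (s 0).1 = (0, 0) ∧ (∀ k : Fin n, Par.Arrow (s k.castSucc) (s k.succ)) ∧
      s (Fin.last n) = lam}

instance {n : ℕ} (lam : Par n) : Finite (Tab lam) := by
  unfold Tab
  infer_instance

instance {n : ℕ} (lam : Par n) : Fintype (Tab lam) := Fintype.ofFinite _

/-- `SHAPE(t|ₖ)`, for `0 ≤ k ≤ n`. -/
def Tab.shape {n : ℕ} {lam : Par n} (t : Tab lam) (k : ℕ) (hk : k ≤ n) : Par k :=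
  t.1 ⟨k, Nat.lt_succ_of_le hk⟩

/-- `s ⊵ t`. -/
def Tab.Dom {n : ℕ} {lam : Par n} (s t : Tab lam) : Prop :=
  ∀ (k : ℕ) (hk : k ≤ n), (s.shape k hk).Dom (t.shape k hk)

/-- `s ▷ t`. -/
def Tab.SDom {n : ℕ} {lam : Par n} (s t : Tab lam) : Prop := s.Dom t ∧ s ≠ t

/-- `m_λ = e₁ e₃ ⋯ e_{2f-1}` for `λ = (f, n - 2f)`. -/
def mLam {n : ℕ} (lam : Par n) : TL n :=
  ((List.range lam.1.1).map fun j => e n (2 * j + 1)).prod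

/-- The two sided ideal `𝒜ₙ^λ` generated by `m_λ`. -/
def idealLam {n : ℕ} (lam : Par n) : TwoSidedIdeal (TL n) := TwoSidedIdeal.span {mLam lam}

/-- The two sided ideal `∑_{μ ▷ λ} 𝒜ₙ^μ`. -/
def idealCheck {n : ℕ} (lam : Par n) : TwoSidedIdeal (TL n) :=
  ⨆ (mu : Par n) (_ : mu.SDom lam), idealLam mu

/-- A two sided ideal, as a right submodule of the algebra. -/
def rightSubmodule {n : ℕ} (I : TwoSidedIdeal (TL n)) : Submodule (TL n)ᵐᵒᵖ (TL n) where
  carrier := {a | a ∈ I}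
  add_mem' := fun ha hb => I.add_mem ha hb
  zero_mem' := I.zero_mem
  smul_mem' := fun c _ ha => I.mul_mem_right _ c.unop ha

/-- The right `𝒜ₙ(x)`-module `𝒜ₙ(x) / ∑_{μ ▷ λ} 𝒜ₙ^μ`. -/
abbrev Quo {n : ℕ} (lam : Par n) : Type := TL n ⧸ rightSubmodule (idealCheck lam)

/-- The class of `m_λ` modulo `∑_{μ ▷ λ} 𝒜ₙ^μ`. -/
def genQuo {n : ℕ} (lam : Par n) : Quo lam := Submodule.Quotient.mk (mLam lam)

/-- The cell module `C^λ`: the right submodule generated by the class of `m_λ`. -/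
def cell {n : ℕ} (lam : Par n) : Submodule (TL n)ᵐᵒᵖ (Quo lam) :=
  Submodule.span (TL n)ᵐᵒᵖ {genQuo lam}

/-- The generator `m_{t^λ}` of `C^λ`. -/
def cellGen {n : ℕ} (lam : Par n) : cell lam :=
  ⟨genQuo lam, Submodule.subset_span (Set.mem_singleton _)⟩

/-- `w_{i,j}`, equal to `eᵢ eᵢ₊₁ ⋯ eⱼ₋₁` if `i < j`, to `eᵢ₋₁ eᵢ₋₂ ⋯ eⱼ` if `j < i`, and to `1`
if `i = j`. -/
def w (n i j : ℕ) : TL n :=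
  if i < j then ((List.range' i (j - i)).map (e n)).prod
  else (((List.range' j (i - j)).reverse).map (e n)).prod

/-- The element `v_{t|ₖ}` of `𝒜ₖ(x)`, regarded as an element of `𝒜ₙ(x)`: with
`SHAPE(t|ₖ) = (f, k - 2f)` it is `v_{t|ₖ₋₁}` if `SHAPE(t|ₖ₋₁) = (f, k - 1 - 2f)`, and
`w_{2f,k} v_{t|ₖ₋₁}` if `SHAPE(t|ₖ₋₁) = (f - 1, k + 1 - 2f)`. -/
def Tab.vRestr {n : ℕ} {lam : Par n} (t : Tab lam) : (k : ℕ) → k ≤ n → TL n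
  | 0, _ => 1
  | k + 1, hk =>
      if (t.shape k (by omega)).1.1 = (t.shape (k + 1) hk).1.1 then t.vRestr k (by omega)
      else w n (2 * (t.shape (k + 1) hk).1.1) (k + 1) * t.vRestr k (by omega)

/-- `v_t`. -/
def Tab.v {n : ℕ} {lam : Par n} (t : Tab lam) : TL n := t.vRestr n le_rfl

/-- `m_t = m_{t^λ} v_t`, an element of `C^λ`. -/
def Tab.m {n : ℕ} {lam : Par n} (t : Tab lam) : cell lam := op t.v • cellGen lam

/-- The Jucys–Murphy elements `Tᵢ`. In the last clause, for `T_{i+1}` with `i = j + 2`, the two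
sums are `z_{i-1}` and `z_{i-2}`; see `T_succ`. -/
def T (n : ℕ) : ℕ → TL n
  | 0 => 0
  | 1 => 0
  | 2 => e n 1
  | j + 3 =>
      -(e n (j + 2) * T n (j + 2)) - T n (j + 2) * e n (j + 2)
        + e n (j + 2) * e n (j + 1) * T n (j + 2) * e n (j + 2)
        - (∑ l : Fin (j + 2), (X ^ (l : ℕ) : ℤ[X]) • T n (j + 1 - l))
        - e n (j + 2) * ∑ l : Fin (j + 1), (X ^ (l : ℕ) : ℤ[X]) • T n (j - l)

/-- `zᵢ = ∑_{l=0}^{i} x^l T_{i-l}`. -/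
def z (n i : ℕ) : TL n := ∑ l : Fin (i + 1), (X ^ (l : ℕ) : ℤ[X]) • T n (i - l)

theorem T_succ (n i : ℕ) (hi : 2 ≤ i) :
    T n (i + 1) = -(e n i * T n i) - T n i * e n i + e n i * e n (i - 1) * T n i * e n i
      - z n (i - 1) - e n i * z n (i - 2) := by
  obtain ⟨j, rfl⟩ : ∃ j, i = j + 2 := ⟨i - 2, by omega⟩
  rw [T]
  rfl

theorem z_one (n : ℕ) : z n 1 = 0 := by
  simp [z, T]

/-- The polynomials `pᵢ`. -/
def p : ℕ → ℤ[X]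
  | 0 => 0
  | 1 => 1
  | i + 2 => X * p (i + 1) - p i

/-- `r_t(k)`, for `0 ≤ k ≤ n`. -/
def Tab.r {n : ℕ} {lam : Par n} (t : Tab lam) : (k : ℕ) → k ≤ n → ℤ[X]
  | 0, _ => 0
  | 1, _ => 0
  | l + 2, hk =>
      let k := l + 2
      let i := (t.shape k hk).1.1
      if (t.shape (l + 1) (by omega)).1.1 + 1 = i then (p i - X * p (i - 1)) * p (k - i + 1)
      else (p (k - i + 1) - X * p (k - i)) * p i

/-- `z_t(k) = ∑_{i=0}^{k} x^i r_t(k-i)`, for `0 ≤ k ≤ n`. -/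
def Tab.z {n : ℕ} {lam : Par n} (t : Tab lam) (k : ℕ) (hk : k ≤ n) : ℤ[X] :=
  ∑ i : Fin (k + 1), X ^ (i : ℕ) * t.r (k - i) (by omega)

end TemperleyLieb

end

noncomputable section

namespace TemperleyLieb

open Polynomial MulOpposite

/-! ### The generators -/

/-! In terms of `z` the definition of `T` becomes the recursion in `ZRec`, proved by induction
together with e_{k+1} z_{k+2} = z_{k+2} e_{k+1} = e_{k+1} z_k + p_{k+2} e_{k+1}. This yields
centrality (`e_z_commute`) and shows that e_1 e_3 ⋯ e_{2f-1} is an exact eigenvector of z_{2f} and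
z_{2f+1} (`oddProd_mul_z_even`, `oddProd_mul_z_odd`).

The elements m_λ v_t are studied in the algebra itself, as `M` of a word of openings (`false`) and
closings (`true`). Generators act on the right as on cup diagrams: a peak is multiplied by x, a
valley becomes a peak, and two equal steps give a strictly dominating path or an element of the
ideal that is factored out (`M_mul_e_mem`).

Triangularity (`triangular`) goes by induction on k and, for fixed k, on the area of the first k
steps. A peak based above height 0 comes from the path with a valley instead, via a generator that
commutes with z_k, so the formula carries over. Without such a peak the k steps are a zigzag
followed by d openings. For d < 2 the element is an exact eigenvector; for d ≥ 2 the recursion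
reduces z_k to z_{k-1} and z_{k-2}, since e_{k-1} only produces dominating paths. Only spanning is
used, never linear independence. -/

theorem e_of_not {n i : ℕ} (h : ¬(1 ≤ i ∧ i < n)) : e n i = 0 := dif_neg h

theorem e_mul_self (n i : ℕ) : e n i * e n i = (X : ℤ[X]) • e n i := by
  by_cases h : 1 ≤ i ∧ i < n
  · simp only [e, dif_pos h]
    rw [← map_mul, ← map_smul]
    exact RingQuot.mkAlgHom_rel ℤ[X] (Rel.sq _)
  · simp [e_of_not h]

theorem e_commute {n i j : ℕ} (hij : i + 2 ≤ j) : e n i * e n j = e n j * e n i := by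
  by_cases h : 1 ≤ i ∧ i < n
  · by_cases h' : 1 ≤ j ∧ j < n
    · simp only [e, dif_pos h, dif_pos h']
      rw [← map_mul, ← map_mul]
      exact RingQuot.mkAlgHom_rel ℤ[X] (Rel.comm _ _ (Or.inl hij))
    · simp [e_of_not h']
  · simp [e_of_not h]

theorem e_braid {n i j : ℕ} (hj : 1 ≤ j ∧ j < n) (hij : j = i + 1 ∨ i = j + 1) :
    e n i * e n j * e n i = e n i := by
  by_cases h : 1 ≤ i ∧ i < n
  · simp only [e, dif_pos h, dif_pos hj]
    rw [← map_mul, ← map_mul]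
    exact RingQuot.mkAlgHom_rel ℤ[X] (Rel.braid _ _ hij)
  · simp [e_of_not h]

theorem e_braid_succ {n i : ℕ} (h : i + 1 < n) : e n i * e n (i + 1) * e n i = e n i :=
  e_braid ⟨by omega, h⟩ (Or.inl rfl)

/-- For `i ≥ n` both sides vanish, `e n (i + 1)` being the default value 0. Hence `ZRec` needs no
bound on `k`. -/
theorem e_succ_braid {n i : ℕ} (h : 1 ≤ i) : e n (i + 1) * e n i * e n (i + 1) = e n (i + 1) := by
  by_cases h' : i < n
  · exact e_braid ⟨h, h'⟩ (Or.inr rfl)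
  · rw [e_of_not (i := i + 1) (by omega)]; simp

/-! ### The elements `w` -/

@[simp] theorem w_self (n i : ℕ) : w n i i = 1 := by simp [w]

theorem w_succ_right (n : ℕ) {i j : ℕ} (h : i ≤ j) : w n i (j + 1) = w n i j * e n j := by
  obtain ⟨d, rfl⟩ := Nat.exists_eq_add_of_le h
  rcases Nat.eq_zero_or_pos d with rfl | hd
  · simp [w]
  · rw [w, w, if_pos (by omega), if_pos (by omega), show i + d + 1 - i = d + 1 by omega,
      show i + d - i = d by omega, List.range'_concat]
    simp

theorem w_succ_left (n : ℕ) {i j : ℕ} (h : i < j) : w n i j = e n i * w n (i + 1) j := by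
  obtain ⟨d, rfl⟩ := Nat.exists_eq_add_of_lt h
  rcases Nat.eq_zero_or_pos d with rfl | hd
  · simp [w]
  · rw [w, w, if_pos (by omega), if_pos (by omega), show i + d + 1 - i = d + 1 by omega,
      show i + d + 1 - (i + 1) = d by omega, List.range'_succ]
    simp

theorem e_w_commute_of_lt {n j a b : ℕ} (hab : a ≤ b) (h : b < j) :
    e n j * w n a b = w n a b * e n j := by
  induction b, hab using Nat.le_induction with
  | base => simp
  | succ b hab ih =>
    rw [w_succ_right n hab, ← mul_assoc, ih (by omega), mul_assoc, ← e_commute (i := b) (by omega),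
      mul_assoc]

theorem e_w_commute_of_gt {n j a b : ℕ} (hab : a ≤ b) (h : j + 2 ≤ a) :
    e n j * w n a b = w n a b * e n j := by
  induction b, hab using Nat.le_induction with
  | base => simp
  | succ b hab ih =>
    rw [w_succ_right n hab, ← mul_assoc, ih, mul_assoc, e_commute (j := b) (by omega), mul_assoc]

/-- As a diagram `w` carries strands across by two places, which lowers the index by 2. In the base
case both sides of `h1` are e_b e_{b+2}. -/
theorem e_mul_w {n a b k : ℕ} (hab : a ≤ b) (hbk : b + 2 ≤ k) (hk : k < n) :
    e n (b + 2) * w n a (k + 1) = w n a (k + 1) * e n b := by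
  induction k, hbk using Nat.le_induction with
  | base =>
    have h1 : e n (b + 2) * e n b * e n (b + 1) * e n (b + 2)
        = e n b * e n (b + 1) * e n (b + 2) * e n b := by
      rw [← e_commute (n := n) (i := b) (j := b + 2) (by omega), mul_assoc (e n b), mul_assoc (e n b),
        e_succ_braid (by omega), mul_assoc _ (e n (b + 2)),
        ← e_commute (n := n) (i := b) (j := b + 2) (by omega), ← mul_assoc, e_braid_succ (by omega)]
    rw [w_succ_right n (by omega), w_succ_right n (by omega), w_succ_right n hab]
    simp only [← mul_assoc]
    rw [e_w_commute_of_lt hab (by omega)]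
    simp only [mul_assoc] at h1 ⊢
    rw [h1]
  | succ k hbk ih =>
    rw [w_succ_right n (by omega), ← mul_assoc, ih (by omega), mul_assoc, mul_assoc,
      e_commute (by omega)]

theorem w_mul_w_slide {n a r k : ℕ} (hr : a + r + 1 ≤ k) (hk : k < n) :
    w n (a + 2) (a + 2 + r) * w n a (k + 1) = w n a (k + 1) * w n a (a + r) := by
  induction r with
  | zero => simp
  | succ r ih =>
    rw [← add_assoc, w_succ_right n (by omega), mul_assoc, show a + 2 + r = a + r + 2 by omega,
      e_mul_w (by omega) (by omega) hk, ← mul_assoc, show a + r + 2 = a + 2 + r by omega,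
      ih (by omega), mul_assoc, ← w_succ_right n (by omega), add_assoc]

/-- The right factor e_a commutes past w_{a+2,k+1} and then e_a e_{a+1} e_a = e_a. -/
theorem w_mul_e_absorb {n a k : ℕ} (hk : a < k) (hkn : k < n) :
    w n a (k + 1) * e n a = w n (a + 2) (k + 1) * e n a := by
  rw [w_succ_left n (by omega), w_succ_left n (by omega), mul_assoc, mul_assoc,
    ← e_w_commute_of_gt (by omega) (by omega), ← mul_assoc (e n (a + 1)), ← mul_assoc, ← mul_assoc,
    e_braid_succ (by omega), e_w_commute_of_gt (by omega) (by omega)]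

/-- Slide, then absorb: `1 ≤ r` provides the letter e_a that shortens the long word. This is the
rewriting behind all changes of steps in `M`. -/
theorem w_mul_w {n a r k : ℕ} (hr : 1 ≤ r) (hrk : a + r + 1 ≤ k) (hk : k < n) :
    w n (a + 2) (k + 1) * w n a (a + r) = w n (a + 2) (a + 2 + r) * w n a (k + 1) := by
  rw [w_mul_w_slide hrk hk, w_succ_left n (show a < a + r by omega), ← mul_assoc, ← mul_assoc,
    w_mul_e_absorb (by omega) hk]

/-! ### The polynomials `p` -/

@[simp] theorem p_zero : p 0 = 0 := rfl
@[simp] theorem p_one : p 1 = 1 := rfl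
theorem p_add_two (i : ℕ) : p (i + 2) = X * p (i + 1) - p i := rfl

/-- The addition formula for Chebyshev polynomials; it adds up the eigenvalues on e_1 e_3 ⋯
e_{2f-1}. -/
theorem p_add (a b : ℕ) : p (a + b + 1) = p (a + 1) * p (b + 1) - p a * p b := by
  induction b using Nat.twoStepInduction with
  | zero => simp
  | one => rw [add_assoc, p_add_two a]; simp [p, mul_comm]
  | more b ih1 ih2 =>
    rw [show a + (b + 2) + 1 = (a + b + 1) + 2 by ring, p_add_two (a + b + 1),
      show a + b + 1 + 1 = a + (b + 1) + 1 by ring, ih1, ih2, p_add_two (b + 1), p_add_two b]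
    ring

/-! ### The Jucys–Murphy elements -/

@[simp] theorem z_zero (n : ℕ) : z n 0 = 0 := by simp [z, T]

theorem z_succ (n i : ℕ) : z n (i + 1) = T n (i + 1) + (X : ℤ[X]) • z n i := by
  rw [z, Fin.sum_univ_succ, z, Finset.smul_sum]
  congr 1
  · simp
  · refine Finset.sum_congr rfl fun l _ => ?_
    rw [smul_smul, Fin.val_succ, pow_succ', Nat.add_sub_add_right]

theorem z_two (n : ℕ) : z n 2 = e n 1 := by
  rw [z_succ, z_one]; simp [T]

theorem e_mem_tower {n j k : ℕ} (h1 : 1 ≤ j) (hj : j < k) : e n j ∈ tower n k :=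
  Algebra.subset_adjoin ⟨j, h1, hj, rfl⟩

theorem tower_mono (n : ℕ) {k l : ℕ} (h : k ≤ l) : tower n k ≤ tower n l :=
  Algebra.adjoin_mono fun _ ⟨j, h1, h2, h3⟩ => ⟨j, h1, by omega, h3⟩

theorem z_mem_of_T_mem {n k : ℕ} (h : ∀ i ≤ k, T n i ∈ tower n k) : z n k ∈ tower n k :=
  sum_mem fun l _ => Subalgebra.smul_mem _ (h _ (by omega)) _

theorem T_mem_tower (n k : ℕ) : T n k ∈ tower n k := by
  induction k using Nat.strong_induction_on with
  | _ k ih =>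
    match k, ih with
    | 0, _ => rw [T]; exact zero_mem _
    | 1, _ => rw [T]; exact zero_mem _
    | 2, _ => rw [T]; exact e_mem_tower le_rfl (by omega)
    | j + 3, ih =>
      have hz : ∀ i ≤ j + 1, z n i ∈ tower n (j + 3) := fun i hi =>
        tower_mono n (show i ≤ j + 3 by omega)
          (z_mem_of_T_mem fun l hl => tower_mono n hl (ih l (by omega)))
      have hT := tower_mono n (show j + 2 ≤ j + 3 by omega) (ih (j + 2) (by omega))
      have e2 : e n (j + 2) ∈ tower n (j + 3) := e_mem_tower (by omega) (by omega)
      have e1 : e n (j + 1) ∈ tower n (j + 3) := e_mem_tower (by omega) (by omega)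
      rw [T_succ n (j + 2) (by omega)]
      exact sub_mem (sub_mem (add_mem (sub_mem (neg_mem (mul_mem e2 hT)) (mul_mem hT e2))
        (mul_mem (mul_mem (mul_mem e2 e1) hT) e2)) (hz _ (by simp))) (mul_mem e2 (hz _ (by simp)))

theorem z_mem_tower (n k : ℕ) : z n k ∈ tower n k :=
  z_mem_of_T_mem fun i hi => tower_mono n hi (T_mem_tower n i)

theorem tower_commute_e {n k j : ℕ} (h : k < j) {a : TL n} (ha : a ∈ tower n k) :
    e n j * a = a * e n j := by
  have : a ∈ Subalgebra.centralizer ℤ[X] {e n j} := by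
    refine Algebra.adjoin_le ?_ ha
    rintro _ ⟨i, _, hi, rfl⟩
    rw [SetLike.mem_coe, Subalgebra.mem_centralizer_iff]
    rintro _ rfl
    exact (e_commute (by omega)).symm
  exact (Subalgebra.mem_centralizer_iff _).1 this _ rfl

theorem e_z_commute_of_lt {n k j : ℕ} (h : k < j) : e n j * z n k = z n k * e n j :=
  tower_commute_e h (z_mem_tower n k)

section Algebra

variable {A : Type*} [Ring A] [Algebra ℤ[X] A] {x q r s : ℤ[X]} {a b Z₀ Z₁ Z₂ Z₃ : A}

/-- The recursion of the central elements, in a form symmetric under reversal of products. -/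
theorem recursion_of (T₂ T₃ : A) (hT₂ : Z₂ = T₂ + x • Z₁) (hZ₃ : Z₃ = T₃ + x • Z₂)
    (hT₃ : T₃ = -(b * T₂) - T₂ * b + b * a * T₂ * b - Z₁ - b * Z₀)
    (hbab : b * a * b = b) (h0b : b * Z₀ = Z₀ * b) (h1b : b * Z₁ = Z₁ * b)
    (key : a * Z₂ = a * Z₀ + q • a) :
    Z₃ = x • Z₂ - Z₁ + q • b + x • (b * Z₁) - b * Z₂ - Z₂ * b := by
  have hT : T₂ = Z₂ - x • Z₁ := by rw [hT₂]; abel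
  -- `key` removes Z₂ from the only term containing `a`, and then bab = b removes `a`. The resulting
  -- b Z₀ cancels the last term of `hT₃`.
  have h1 : b * a * T₂ * b = b * Z₀ + q • b - x • (b * Z₁) := by
    rw [hT, mul_assoc b, mul_sub, key, mul_smul_comm]
    simp only [mul_sub, sub_mul, mul_add, add_mul, mul_smul_comm, smul_mul_assoc]
    rw [← mul_assoc b a Z₀, mul_assoc (b * a), ← h0b, ← mul_assoc, hbab, ← mul_assoc b a Z₁,
      mul_assoc (b * a), ← h1b, ← mul_assoc, hbab]
  rw [hZ₃, hT₃, h1, hT]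
  simp only [mul_sub, sub_mul, mul_smul_comm, smul_mul_assoc, ← h1b]
  module

/-- Z₀ and Z₁ commute with b, so the sandwich meets only bb and bab, and the two Z₀ terms cancel. -/
theorem mul_mul_of
    (hZ₂ : Z₂ = x • Z₁ - Z₀ + s • a + x • (a * Z₀) - a * Z₁ - Z₁ * a)
    (hb : b * b = x • b) (hbab : b * a * b = b) (h0b : b * Z₀ = Z₀ * b) (h1b : b * Z₁ = Z₁ * b) :
    b * Z₂ * b = (x * x - 2) • (b * Z₁) + s • b := by
  have h1 : b * (a * Z₀) * b = b * Z₀ := by rw [mul_assoc, mul_assoc, ← h0b, ← mul_assoc, ← mul_assoc, hbab]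
  have h2 : b * (a * Z₁) * b = b * Z₁ := by rw [mul_assoc, mul_assoc, ← h1b, ← mul_assoc, ← mul_assoc, hbab]
  have h3 : b * (Z₁ * a) * b = b * Z₁ := by rw [← mul_assoc, h1b, mul_assoc, mul_assoc, ← mul_assoc b, hbab]
  have h4 : b * Z₁ * b = x • (b * Z₁) := by rw [mul_assoc, ← h1b, ← mul_assoc, hb, smul_mul_assoc]
  have h5 : b * Z₀ * b = x • (b * Z₀) := by rw [mul_assoc, ← h0b, ← mul_assoc, hb, smul_mul_assoc]
  rw [hZ₂]
  simp only [mul_sub, sub_mul, mul_add, add_mul, mul_smul_comm, smul_mul_assoc, h1, h2, h3, h4,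
    h5, hbab]
  module

theorem mul_left_of
    (hZ₂ : Z₂ = x • Z₁ - Z₀ + s • a + x • (a * Z₀) - a * Z₁ - Z₁ * a)
    (hZ₃ : Z₃ = x • Z₂ - Z₁ + q • b + x • (b * Z₁) - b * Z₂ - Z₂ * b)
    (hb : b * b = x • b) (hbab : b * a * b = b) (h0b : b * Z₀ = Z₀ * b)
    (h1b : b * Z₁ = Z₁ * b) (hr : r = x * q - s) : b * Z₃ = b * Z₁ + r • b := by
  have h := mul_mul_of hZ₂ hb hbab h0b h1b
  rw [hZ₃, hr]
  simp only [mul_sub, mul_add, mul_smul_comm, ← mul_assoc, hb, h, smul_mul_assoc]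
  module

theorem mul_right_of
    (hZ₂ : Z₂ = x • Z₁ - Z₀ + s • a + x • (a * Z₀) - a * Z₁ - Z₁ * a)
    (hZ₃ : Z₃ = x • Z₂ - Z₁ + q • b + x • (b * Z₁) - b * Z₂ - Z₂ * b)
    (hb : b * b = x • b) (hbab : b * a * b = b) (h0b : b * Z₀ = Z₀ * b)
    (h1b : b * Z₁ = Z₁ * b) (hr : r = x * q - s) : Z₃ * b = b * Z₁ + r • b := by
  have h := mul_mul_of hZ₂ hb hbab h0b h1b
  have h6 : b * Z₁ * b = x • (b * Z₁) := by rw [mul_assoc, ← h1b, ← mul_assoc, hb, smul_mul_assoc]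
  have h7 : Z₂ * b * b = x • (Z₂ * b) := by rw [mul_assoc, hb, mul_smul_comm]
  rw [hZ₃, hr]
  simp only [sub_mul, add_mul, smul_mul_assoc, hb, h, h6, h7, ← h1b]
  module

/-- The right-hand side is the same as in `prev_mul_right_of`: this makes a commute with Z₃ without
assuming that a commutes with Z₁. -/
theorem prev_mul_left_of
    (hZ₂ : Z₂ = x • Z₁ - Z₀ + s • a + x • (a * Z₀) - a * Z₁ - Z₁ * a)
    (hZ₃ : Z₃ = x • Z₂ - Z₁ + q • b + x • (b * Z₁) - b * Z₂ - Z₂ * b)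
    (haba : a * b * a = a) (h0b : b * Z₀ = Z₀ * b)
    (h1b : b * Z₁ = Z₁ * b) (key : a * Z₂ = a * Z₀ + q • a) (hr : r = x * q - s) :
    a * Z₃ = r • a + a * Z₁ * b * a := by
  have h : a * (b * Z₂) = x • (a * (b * Z₁)) - a * (b * Z₀) + s • a + x • (a * Z₀) - a * Z₁
      - a * Z₁ * b * a := by
    have h1 : a * (b * (a * Z₀)) = a * Z₀ := by rw [← mul_assoc, ← mul_assoc, haba]
    have h2 : a * (b * (a * Z₁)) = a * Z₁ := by rw [← mul_assoc, ← mul_assoc, haba]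
    have h3 : a * (b * (Z₁ * a)) = a * Z₁ * b * a := by rw [← mul_assoc b, h1b]; simp only [mul_assoc]
    have h4 : a * (b * a) = a := by rw [← mul_assoc, haba]
    rw [hZ₂]
    simp only [mul_sub, mul_add, mul_smul_comm, h1, h2, h3, h4]
  have h' : a * (Z₂ * b) = a * (b * Z₀) + q • (a * b) := by
    rw [← mul_assoc, key, add_mul, smul_mul_assoc, mul_assoc, ← h0b]
  rw [hZ₃, hr]
  simp only [mul_sub, mul_add, mul_smul_comm, h, h', key]
  module

theorem prev_mul_right_of
    (hZ₂ : Z₂ = x • Z₁ - Z₀ + s • a + x • (a * Z₀) - a * Z₁ - Z₁ * a)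
    (hZ₃ : Z₃ = x • Z₂ - Z₁ + q • b + x • (b * Z₁) - b * Z₂ - Z₂ * b)
    (haba : a * b * a = a) (h0a : a * Z₀ = Z₀ * a) (h0b : b * Z₀ = Z₀ * b)
    (h1b : b * Z₁ = Z₁ * b) (key : Z₂ * a = a * Z₀ + q • a) (hr : r = x * q - s) :
    Z₃ * a = r • a + a * Z₁ * b * a := by
  have h : Z₂ * b * a = x • (Z₁ * b * a) - Z₀ * b * a + s • a + x • (Z₀ * a) - Z₁ * a
      - a * Z₁ * b * a := by
    have h1 : a * Z₀ * b * a = Z₀ * a := by rw [h0a, mul_assoc, mul_assoc, ← mul_assoc a, haba]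
    have h3 : Z₁ * a * b * a = Z₁ * a := by rw [mul_assoc, mul_assoc, ← mul_assoc a, haba]
    rw [hZ₂]
    simp only [sub_mul, add_mul, smul_mul_assoc, h1, h3, haba]
    module
  have h' : b * Z₂ * a = Z₀ * b * a + q • (b * a) := by
    rw [mul_assoc, key, mul_add, mul_smul_comm, h0a, ← mul_assoc, h0b]
  rw [hZ₃, hr]
  simp only [sub_mul, add_mul, smul_mul_assoc, h, h', key, h0a, h1b]
  module

end Algebra

/-- The recursion for `z`, and the products of `z` with the last generator. -/
structure ZRec (n k : ℕ) : Prop where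
  recursion : z n (k + 2) = (X : ℤ[X]) • z n (k + 1) - z n k + p (k + 1) • e n (k + 1)
    + (X : ℤ[X]) • (e n (k + 1) * z n k) - e n (k + 1) * z n (k + 1) - z n (k + 1) * e n (k + 1)
  left : e n (k + 1) * z n (k + 2) = e n (k + 1) * z n k + p (k + 2) • e n (k + 1)
  right : z n (k + 2) * e n (k + 1) = e n (k + 1) * z n k + p (k + 2) • e n (k + 1)

theorem zRec_zero (n : ℕ) : ZRec n 0 := by
  constructor <;> simp [z_two, z_one, e_mul_self, p]

theorem ZRec.succ {n k : ℕ} (h : ZRec n k) : ZRec n (k + 1) := by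
  have hb := e_mul_self n (k + 2)
  have hbab : e n (k + 2) * e n (k + 1) * e n (k + 2) = e n (k + 2) := e_succ_braid (by omega)
  have h0b : e n (k + 2) * z n k = z n k * e n (k + 2) := e_z_commute_of_lt (by omega)
  have h1b : e n (k + 2) * z n (k + 1) = z n (k + 1) * e n (k + 2) := e_z_commute_of_lt (by omega)
  have hr := recursion_of (T n (k + 2)) (T n (k + 3)) (z_succ n (k + 1)) (z_succ n (k + 2))
    (T_succ n (k + 2) (by omega)) hbab h0b h1b h.left
  exact ⟨hr, mul_left_of h.recursion hr hb hbab h0b h1b (p_add_two (k + 1)),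
    mul_right_of h.recursion hr hb hbab h0b h1b (p_add_two (k + 1))⟩

theorem zRec (n k : ℕ) : ZRec n k := by
  induction k with
  | zero => exact zRec_zero n
  | succ k ih => exact ih.succ

theorem e_mul_z_add_two {n k : ℕ} (hk : k + 2 < n) : e n (k + 1) * z n (k + 3) =
    p (k + 3) • e n (k + 1) + e n (k + 1) * z n (k + 1) * e n (k + 2) * e n (k + 1) :=
  prev_mul_left_of (zRec n k).recursion (zRec n (k + 1)).recursion (e_braid_succ hk)
    (e_z_commute_of_lt (by omega)) (e_z_commute_of_lt (by omega))
    (zRec n k).left (p_add_two (k + 1))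

theorem z_add_two_mul_e {n k : ℕ} (hk : k + 2 < n) : z n (k + 3) * e n (k + 1) =
    p (k + 3) • e n (k + 1) + e n (k + 1) * z n (k + 1) * e n (k + 2) * e n (k + 1) :=
  prev_mul_right_of (zRec n k).recursion (zRec n (k + 1)).recursion (e_braid_succ hk)
    (e_z_commute_of_lt (by omega)) (e_z_commute_of_lt (by omega)) (e_z_commute_of_lt (by omega))
    (zRec n k).right (p_add_two (k + 1))

/-- The top generator is covered by `ZRec`, the one below it by the two preceding lemmas; all lower
ones commute with every term of the recursion. -/
theorem e_z_commute {n k j : ℕ} (hk : k ≤ n) (hj : j < k) : e n j * z n k = z n k * e n j := by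
  induction k using Nat.twoStepInduction generalizing j with
  | zero => simp
  | one => simp [z_one]
  | more k ih1 ih2 =>
    rcases (show j = k + 1 ∨ j = k ∨ j < k by omega) with rfl | rfl | h
    · rw [(zRec n k).left, (zRec n k).right]
    · cases j with
      | zero => simp [e_of_not]
      | succ j => rw [e_mul_z_add_two (by omega), z_add_two_mul_e (by omega)]
    · have hc : Commute (e n j) (e n (k + 1)) := e_commute (by omega)
      have h0 : Commute (e n j) (z n k) := ih1 (by omega) h
      have h1 : Commute (e n j) (z n (k + 1)) := ih2 (by omega) (by omega)
      rw [(zRec n k).recursion]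
      exact (((((h1.smul_right _).sub_right h0).add_right (hc.smul_right _)).add_right
        ((hc.mul_right h0).smul_right _)).sub_right (hc.mul_right h1)).sub_right (h1.mul_right hc)

theorem z_central {n k : ℕ} (hk : k ≤ n) {a : TL n} (ha : a ∈ tower n k) :
    z n k * a = a * z n k := by
  have : a ∈ Subalgebra.centralizer ℤ[X] {z n k} := by
    refine Algebra.adjoin_le ?_ ha
    rintro _ ⟨i, _, hi, rfl⟩
    rw [SetLike.mem_coe, Subalgebra.mem_centralizer_iff]
    rintro _ rfl
    exact (e_z_commute hk hi).symm
  exact (Subalgebra.mem_centralizer_iff _).1 this _ rfl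

/-! ### The elements `e₁ e₃ ⋯ e_{2f-1}` -/

/-- `e₁ e₃ ⋯ e_{2f-1}`. -/
def oddProd (n f : ℕ) : TL n := ((List.range f).map fun j => e n (2 * j + 1)).prod

@[simp] theorem oddProd_zero (n : ℕ) : oddProd n 0 = 1 := rfl

theorem oddProd_succ (n f : ℕ) : oddProd n (f + 1) = oddProd n f * e n (2 * f + 1) := by
  simp [oddProd, List.range_succ]

theorem e_oddProd_commute {n f j : ℕ} (h : 2 * f + 1 ≤ j) :
    e n j * oddProd n f = oddProd n f * e n j := by
  induction f with
  | zero => simp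
  | succ f ih =>
    rw [oddProd_succ, ← mul_assoc, ih (by omega), mul_assoc, ← e_commute (j := j) (by omega),
      mul_assoc]

/-- The last factor e_{2f+1} turns z_{2f+2} into z_{2f} + p_{2f+2}. -/
theorem oddProd_mul_z_even {n f : ℕ} :
    oddProd n f * z n (2 * f) = (p f * p (f + 1)) • oddProd n f := by
  induction f with
  | zero => simp
  | succ f ih =>
    rw [oddProd_succ, mul_assoc, show 2 * (f + 1) = 2 * f + 2 by ring, (zRec n (2 * f)).left,
      e_z_commute_of_lt (by omega), mul_add, ← mul_assoc, ih, mul_smul_comm, smul_mul_assoc,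
      ← add_smul]
    have := p_add (f + 1) f
    rw [show f + 1 + f + 1 = 2 * f + 2 by ring] at this
    rw [this]
    ring_nf

/-- Once z_{2f+1} has met the shorter product and become a scalar, e_{2f+1} e_{2f+2} e_{2f+1}
collapses. -/
theorem oddProd_mul_z_odd {n f : ℕ} (hf : 2 * f + 1 ≤ n) :
    oddProd n f * z n (2 * f + 1) = (p f * p (f + 2)) • oddProd n f := by
  induction f with
  | zero => simp [z_one]
  | succ f ih =>
    rw [show 2 * (f + 1) + 1 = 2 * f + 3 by ring, oddProd_succ, mul_assoc,
      e_mul_z_add_two (by omega), mul_add, ← mul_assoc, ← mul_assoc, ← mul_assoc,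
      ← e_oddProd_commute le_rfl, mul_assoc (e n _) (oddProd n f), ih (by omega), mul_smul_comm,
      mul_smul_comm, e_oddProd_commute le_rfl, smul_mul_assoc, smul_mul_assoc,
      mul_assoc (oddProd n f), mul_assoc (oddProd n f), e_braid_succ (by omega), ← add_smul]
    have := p_add (f + 2) f
    rw [show f + 2 + f + 1 = 2 * f + 3 by ring] at this
    rw [this]
    ring_nf

/-! ### Words

A path is encoded by a word in the letters `true` (the first part of the partition grows) and
`false`, the head of the list being the last step of the path. -/

/-- The number of letters `true` of a word: the first part of its shape. -/
def dn (s : List Bool) : ℕ := s.count true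

@[simp] theorem dn_nil : dn [] = 0 := rfl
@[simp] theorem dn_true (s : List Bool) : dn (true :: s) = dn s + 1 := by simp [dn]
@[simp] theorem dn_false (s : List Bool) : dn (false :: s) = dn s := by simp [dn]
@[simp] theorem dn_append (r s : List Bool) : dn (r ++ s) = dn r + dn s := by simp [dn]

/-- The words that encode paths. -/
def Ballot : List Bool → Prop
  | [] => True
  | a :: s => 2 * dn (a :: s) ≤ s.length + 1 ∧ Ballot s

theorem Ballot.two_mul_dn_le {s : List Bool} (h : Ballot s) : 2 * dn s ≤ s.length := by
  cases s with
  | nil => simp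
  | cons a s => exact h.1

theorem Ballot.of_append {r s : List Bool} (h : Ballot (r ++ s)) : Ballot s := by
  induction r with
  | nil => exact h
  | cons a r ih => exact ih h.2

theorem Ballot.false_cons {s : List Bool} (h : Ballot s) : Ballot (false :: s) :=
  ⟨by have := h.two_mul_dn_le; simp only [dn_false]; omega, h⟩

/-- With no more closings at the bottom, the heights along `r` cannot drop. -/
theorem Ballot.append_congr {r s s' : List Bool} (h : Ballot (r ++ s)) (h' : Ballot s')
    (hd : dn s' ≤ dn s) (hl : s.length = s'.length) : Ballot (r ++ s') := by
  induction r with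
  | nil => exact h'
  | cons a r ih =>
    refine ⟨?_, ih h.2⟩
    have := h.1
    cases a <;> simp_all <;> omega

/-- Ballot words can be put on top of each other. -/
theorem Ballot.append {r s : List Bool} (h : Ballot r) (h' : Ballot s) : Ballot (r ++ s) := by
  induction r with
  | nil => exact h'
  | cons a r ih =>
    refine ⟨?_, ih h.2⟩
    have := h.1
    have := h'.two_mul_dn_le
    cases a <;> simp_all <;> omega

/-- The element `m_λ v_t` attached to a word. -/
def M (n : ℕ) : List Bool → TL n
  | [] => 1
  | false :: s => M n s
  | true :: s => w n (2 * dn s + 1) (s.length + 1) * M n s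

/-- The element `v_t` attached to a word. -/
def vWord (n : ℕ) : List Bool → TL n
  | [] => 1
  | false :: s => vWord n s
  | true :: s => w n (2 * dn s + 2) (s.length + 1) * vWord n s

/-- The factor by which steps `r` after a path of length `l` and shape `(d, l - 2d)` change `M`. -/
def MSteps (n d l : ℕ) : List Bool → TL n
  | [] => 1
  | false :: r => MSteps n d l r
  | true :: r => w n (2 * (dn r + d) + 1) (r.length + l + 1) * MSteps n d l r

/-- Later steps see the earlier path only through its shape and length, and they multiply from the
left; so a local change can be computed without `r`. -/
theorem M_append (n : ℕ) (r s : List Bool) : M n (r ++ s) = MSteps n (dn s) s.length r * M n s := by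
  induction r with
  | nil => simp [MSteps]
  | cons a r ih => cases a <;> simp [M, MSteps, ih, mul_assoc]

theorem e_M_commute {n j : ℕ} {s : List Bool} (hs : Ballot s) (h : s.length < j) :
    e n j * M n s = M n s * e n j := by
  induction s with
  | nil => simp [M]
  | cons a s ih =>
    simp only [List.length_cons] at h
    have h1 := hs.1
    cases a
    · exact ih hs.2 (by omega)
    · simp only [dn_true] at h1
      rw [M, ← mul_assoc, e_w_commute_of_lt (by omega) h, mul_assoc, ih hs.2 (by omega), mul_assoc]

/-- In `M` each closing contributes one letter more than in `vWord`, namely e_{2f-1}; together these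
letters form m_λ. -/
theorem M_eq {n : ℕ} {s : List Bool} (hs : Ballot s) : M n s = oddProd n (dn s) * vWord n s := by
  induction s with
  | nil => simp [M, vWord]
  | cons a s ih =>
    have h1 := hs.1
    cases a
    · simp only [M, vWord, dn_false]; exact ih hs.2
    · simp only [dn_true] at h1
      have hc : ∀ b, 2 * dn s + 1 ≤ b → w n (2 * dn s + 1) b * oddProd n (dn s)
          = oddProd n (dn s) * w n (2 * dn s + 1) b := by
        intro b hb
        induction b, hb using Nat.le_induction with
        | base => simp
        | succ b hb ihb =>
          rw [w_succ_right n hb, mul_assoc, e_oddProd_commute hb, ← mul_assoc, ihb, mul_assoc]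
      rw [M, vWord, ih hs.2, dn_true, oddProd_succ, ← mul_assoc, hc _ (by omega),
        w_succ_left n (by omega)]
      simp only [mul_assoc]

/-- Flipping a step which is never undone. -/
theorem M_flip {n : ℕ} {s₁ s₂ : List Bool} (h₁ : Ballot s₁)
    (hr : 2 * dn s₂ < s₂.length) (hn : s₁.length + s₂.length + 1 ≤ n) :
    M n (s₁ ++ true :: s₂) = w n (2 * (dn s₁ + dn s₂) + 1)
      (2 * dn s₁ + s₂.length + 1) * M n (s₁ ++ false :: s₂) := by
  induction s₁ with
  | nil => simp [M]
  | cons a s ih =>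
    have h1 := h₁.1
    simp only [List.length_cons] at hn
    have ih := ih h₁.2 (by omega)
    cases a
    · simpa [M] using ih
    · simp only [dn_true] at h1
      rw [List.cons_append, List.cons_append, M, M, ih, ← mul_assoc, ← mul_assoc]
      congr 1
      -- `r + 1` is the number of strands open after `s₂`; its positivity is what `w_mul_w`
      -- requires.
      obtain ⟨r, hr'⟩ := Nat.exists_eq_add_of_lt hr
      have key := w_mul_w (n := n) (a := 2 * (dn s + dn s₂) + 1) (r := r + 1)
        (k := s.length + s₂.length + 1) (by omega) (by omega) (by omega)
      simp only [dn_append, dn_true, dn_false, List.length_append, List.length_cons]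
      convert key using 3 <;> omega

/-- A generator that joins two open strands can be moved to the left of the word. -/
theorem M_mul_e_open {n : ℕ} {s₀ s₁ : List Bool} (h₀ : Ballot s₀) (h₁ : Ballot s₁)
    (hn : s₁.length + s₀.length + 2 ≤ n) :
    M n (s₁ ++ false :: false :: s₀) * e n (s₀.length + 1)
      = e n (2 * dn s₁ + s₀.length + 1) * M n (s₁ ++ false :: false :: s₀) := by
  induction s₁ with
  | nil => simp [M, e_M_commute h₀]
  | cons a s ih =>
    have h1 := h₁.1
    have h0 := h₀.two_mul_dn_le
    simp only [List.length_cons] at hn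
    have ih := ih h₁.2 (by omega)
    cases a
    · simpa [M] using ih
    · simp only [dn_true] at h1
      rw [List.cons_append, M, mul_assoc, ih, ← mul_assoc, ← mul_assoc]
      congr 1
      have key := e_mul_w (n := n) (a := 2 * (dn s + dn s₀) + 1) (b := 2 * dn s + s₀.length + 1)
        (k := s.length + s₀.length + 2) (by omega) (by omega) (by omega)
      simp only [dn_append, dn_true, dn_false, List.length_append, List.length_cons]
      convert key.symm using 3 <;> omega

/-- A peak. -/
theorem M_mul_e_peak {n : ℕ} {s : List Bool} (hs : Ballot s) (r : List Bool) :
    M n (r ++ true :: false :: s) * e n (s.length + 1)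
      = (X : ℤ[X]) • M n (r ++ true :: false :: s) := by
  have h0 := hs.two_mul_dn_le
  rw [M_append, M, M]
  simp only [dn_false, List.length_cons]
  rw [w_succ_right n (by omega), mul_assoc, mul_assoc, mul_assoc, ← e_M_commute hs (by omega), ← mul_assoc (e n _), e_mul_self]
  simp [mul_assoc]

/-- A valley is turned into a peak. -/
theorem M_mul_e_valley {n : ℕ} {s : List Bool} (hs : Ballot (true :: s)) (r : List Bool) :
    M n (r ++ false :: true :: s) * e n (s.length + 1) = M n (r ++ true :: false :: s) := by
  have h0 := hs.1
  rw [dn_true] at h0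
  rw [M_append, M_append, M, M, M, M, dn_false, dn_false, dn_true, dn_true, dn_false,
    List.length_cons, List.length_cons, List.length_cons, List.length_cons,
    w_succ_right n (show 2 * dn s + 1 ≤ s.length + 1 by omega), mul_assoc, mul_assoc, mul_assoc,
    e_M_commute hs.2 (by omega)]

/-- Two openings, the second of which is closed later. -/
theorem M_mul_e_up_up {n : ℕ} {s₀ s₁ : List Bool} (h₀ : Ballot s₀) (h₁ : Ballot s₁)
    (hb : s₁.length = 2 * dn s₁) (hn : s₁.length + s₀.length + 3 ≤ n) (r : List Bool) :
    M n (r ++ true :: (s₁ ++ false :: false :: s₀)) * e n (s₀.length + 1)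
      = M n (r ++ false :: (s₁ ++ true :: false :: s₀)) := by
  have h0 := h₀.two_mul_dn_le
  rw [M_append, M_append, M, M, M_flip h₁ (by simp; omega) (by simp; omega),
    mul_assoc, mul_assoc, M_mul_e_open h₀ h₁ (by omega), ← mul_assoc (w n _ _)]
  have key : w n (2 * dn (s₁ ++ false :: false :: s₀) + 1)
        ((s₁ ++ false :: false :: s₀).length + 1) * e n (2 * dn s₁ + s₀.length + 1)
      = w n (2 * (dn s₁ + dn (false :: s₀)) + 1) (2 * dn s₁ + (false :: s₀).length + 1) := by
    simp only [dn_append, dn_false, List.length_append, List.length_cons]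
    rw [show s₁.length + (s₀.length + 1 + 1) + 1 = 2 * dn s₁ + s₀.length + 3 by omega,
      w_succ_right n (by omega), w_succ_right n (by omega), ← add_assoc,
      mul_assoc, mul_assoc, ← mul_assoc (e n _), e_braid_succ (by omega),
      ← w_succ_right n (by omega)]
  rw [key]
  simp [add_assoc, add_comm, add_left_comm]

/-- Two closings. -/
theorem M_mul_e_down_down {n : ℕ} {s₀ s₁ : List Bool} (h₀ : Ballot s₀) (h₁ : Ballot s₁)
    (hb : s₁.length = 2 * dn s₁) (hs : 2 * dn s₀ < s₀.length)
    (hn : s₁.length + s₀.length + 3 ≤ n) (r : List Bool) :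
    M n (r ++ true :: true :: (s₁ ++ false :: s₀)) * e n ((s₁ ++ false :: s₀).length + 1)
      = M n (r ++ true :: false :: (s₁ ++ true :: s₀)) := by
  have hB : Ballot (s₁ ++ false :: s₀) := h₁.append h₀.false_cons
  have h0 := hB.two_mul_dn_le
  rw [M_append, M_append, M, M, M, M, M_flip h₁ hs (by omega), mul_assoc, mul_assoc, mul_assoc,
    ← e_M_commute hB (by omega)]
  obtain ⟨d, hd⟩ := Nat.exists_eq_add_of_lt hs
  have key := w_mul_w (n := n) (a := 2 * (dn s₁ + dn s₀) + 1) (r := d + 1)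
        (k := s₁.length + s₀.length + 2) (by omega) (by omega) (by omega)
  simp only [dn_append, dn_true, dn_false, List.length_append, List.length_cons] at h0 ⊢
  rw [← mul_assoc (w n (2 * (dn s₁ + dn s₀) + 1) _), ← w_succ_right n (by omega)]
  rw [← mul_assoc (w n (2 * (dn s₁ + dn s₀ + 1) + 1) _),
    ← mul_assoc (w n (2 * (dn s₁ + (dn s₀ + 1)) + 1) _)]
  congr 2
  symm
  convert key using 3 <;> omega

/-! ### The dominance order on words -/

/-- Dominance of words. -/
def Dom : List Bool → List Bool → Prop
  | [], [] => True
  | a :: s, b :: t => dn (b :: t) ≤ dn (a :: s) ∧ Dom s t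
  | _, _ => False

theorem Dom.refl (s : List Bool) : Dom s s := by
  induction s with
  | nil => trivial
  | cons a s ih => exact ⟨le_rfl, ih⟩

theorem Dom.dn_le {s t : List Bool} (h : Dom s t) : dn t ≤ dn s := by
  cases s <;> cases t <;> simp_all [Dom]

theorem Dom.trans {s t u : List Bool} (h : Dom s t) (h' : Dom t u) : Dom s u := by
  induction s generalizing t u with
  | nil => cases t <;> cases u <;> simp_all [Dom]
  | cons a s ih =>
    cases t with
    | nil => exact h.elim
    | cons b t =>
      cases u with
      | nil => exact h'.elim
      | cons c u => exact ⟨h'.1.trans h.1, ih h.2 h'.2⟩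

theorem Dom.antisymm {s t : List Bool} (h : Dom s t) (h' : Dom t s) : s = t := by
  induction s generalizing t with
  | nil => cases t <;> simp_all [Dom]
  | cons a s ih =>
    cases t with
    | nil => exact h.elim
    | cons b t =>
      obtain rfl := ih h.2 h'.2
      have h1 := h.1
      have h2 := h'.1
      cases a <;> cases b <;> simp_all

theorem Dom.append_left {s t : List Bool} (h : Dom s t) (r : List Bool) : Dom (r ++ s) (r ++ t) := by
  induction r with
  | nil => exact h
  | cons a r ih => exact ⟨by have := h.dn_le; cases a <;> simp <;> omega, ih⟩

theorem Dom.of_append {r r' s t : List Bool} (hr : r.length = r'.length)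
    (h : Dom (r ++ s) (r' ++ t)) : Dom s t := by
  induction r generalizing r' with
  | nil => rw [List.length_nil, eq_comm, List.length_eq_zero_iff] at hr; subst hr; exact h
  | cons a r ih =>
    cases r' with
    | nil => simp at hr
    | cons b r' => exact ih (by simpa using hr) h.2

theorem Dom.append_congr {r r' s t s' t' : List Bool} (hr : r.length = r'.length)
    (h : Dom (r ++ s) (r' ++ t)) (h' : Dom s' t') (hs : dn s = dn s') (ht : dn t = dn t') :
    Dom (r ++ s') (r' ++ t') := by
  induction r generalizing r' with
  | nil => rw [List.length_nil, eq_comm, List.length_eq_zero_iff] at hr; subst hr; exact h'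
  | cons a r ih =>
    cases r' with
    | nil => simp at hr
    | cons b r' =>
      refine ⟨?_, ih (by simpa using hr) h.2⟩
      have := h.1
      cases a <;> cases b <;> simp_all

/-- Strict dominance of words. -/
def SDom (s t : List Bool) : Prop := Dom s t ∧ s ≠ t

theorem Dom.trans_sDom {s t u : List Bool} (h : Dom s t) (h' : SDom t u) : SDom s u :=
  ⟨h.trans h'.1, by rintro rfl; exact h'.2 (h'.1.antisymm h)⟩

theorem SDom.trans_dom {s t u : List Bool} (h : SDom s t) (h' : Dom t u) : SDom s u :=
  ⟨h.1.trans h', by rintro rfl; exact h.2 (h.1.antisymm h')⟩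

theorem sDom_valley_peak (r q : List Bool) :
    SDom (r ++ false :: true :: q) (r ++ true :: false :: q) := by
  have h : Dom (false :: true :: q) (true :: false :: q) := ⟨by simp, by simp, Dom.refl q⟩
  refine ⟨h.append_left r, fun h => ?_⟩
  simp at h

/-! ### Decompositions of words -/

/-- If `r` goes below its starting height, take the first step that does so: what precedes it is
balanced. -/
theorem ballot_or_exists_eq (r : List Bool) : Ballot r ∨
    ∃ r' s, r = r' ++ true :: s ∧ Ballot s ∧ s.length = 2 * dn s := by
  induction r with
  | nil => exact Or.inl trivial
  | cons a r ih =>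
    rcases ih with h | ⟨r', s, rfl, h⟩
    · cases a
      · exact Or.inl h.false_cons
      · by_cases h2 : 2 * (dn r + 1) ≤ r.length + 1
        · exact Or.inl ⟨by simpa using h2, h⟩
        · exact Or.inr ⟨[], r, rfl, h, by have := h.two_mul_dn_le; omega⟩
    · exact Or.inr ⟨a :: r', s, rfl, h⟩

/-- The last unmatched opening: a final closing is matched with the last one of the steps before it,
so the search resumes below that. -/
theorem exists_last_open (q : List Bool) (hq : Ballot q) (h : 2 * dn q < q.length) :
    ∃ s₁ s₀, q = s₁ ++ false :: s₀ ∧ Ballot s₁ ∧ s₁.length = 2 * dn s₁ := by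
  induction hl : q.length using Nat.strong_induction_on generalizing q with
  | _ l ih =>
    subst hl
    match q, hq, h, ih with
    | false :: q, _, _, _ => exact ⟨[], q, rfl, trivial, rfl⟩
    | true :: q, hq, h, ih =>
      simp only [dn_true, List.length_cons] at h
      obtain ⟨s₁, s₀, rfl, h₁, h₁'⟩ := ih q.length (by simp) q hq.2 (by omega) rfl
      simp only [dn_append, dn_false, List.length_append, List.length_cons] at h
      have h₀ : Ballot s₀ := (Ballot.of_append (r := s₁ ++ [false]) (by simpa using hq.2))
      obtain ⟨s₂, s₃, rfl, h₂, h₂'⟩ := ih s₀.length (by simp; omega) s₀ h₀ (by omega) rfl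
      refine ⟨true :: (s₁ ++ false :: s₂), s₃, by simp, ⟨?_, h₁.append h₂.false_cons⟩, ?_⟩
      · simp; omega
      · simp; omega

/-- `i` times an opening followed by a closing. -/
def zigzag : ℕ → List Bool
  | 0 => []
  | i + 1 => true :: false :: zigzag i

@[simp] theorem dn_zigzag (i : ℕ) : dn (zigzag i) = i := by
  induction i <;> simp_all [zigzag]

@[simp] theorem length_zigzag (i : ℕ) : (zigzag i).length = 2 * i := by
  induction i <;> simp_all [zigzag]; omega

theorem M_zigzag (n i : ℕ) : M n (zigzag i) = oddProd n i := by
  induction i with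
  | zero => rfl
  | succ i ih =>
    rw [zigzag, M, M, ih, oddProd_succ, dn_false, List.length_cons, dn_zigzag, length_zigzag,
      w_succ_right n le_rfl, w_self, one_mul, e_oddProd_commute le_rfl]

/-- If every peak stands on the ground, descents start at height one only, so the path zigzags and
then just rises. -/
theorem exists_peak_or_eq (u : List Bool) (hu : Ballot u) :
    (∃ u₁ u₀, u = u₁ ++ true :: false :: u₀ ∧ 2 * dn u₀ < u₀.length) ∨
    ∃ d i, u = List.replicate d false ++ zigzag i := by
  induction u with
  | nil => exact Or.inr ⟨0, 0, rfl⟩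
  | cons a u ih =>
    rcases ih hu.2 with ⟨u₁, u₀, rfl, h⟩ | ⟨d, i, rfl⟩
    · exact Or.inl ⟨a :: u₁, u₀, rfl, h⟩
    · cases a
      · exact Or.inr ⟨d + 1, i, rfl⟩
      · match d with
        | 0 =>
          have := hu.1
          simp at this
          omega
        | 1 => exact Or.inr ⟨0, i + 1, rfl⟩
        | d + 2 =>
          refine Or.inl ⟨[], List.replicate (d + 1) false ++ zigzag i, rfl, ?_⟩
          simp [dn, List.count_replicate]
          have := dn_zigzag i
          rw [dn] at this
          omega

/-- The area below a path, up to normalization. -/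
def area : List Bool → ℕ
  | [] => 0
  | a :: s => (a :: s).count false + area s

theorem area_append_lt {s t : List Bool} (h : s.count false = t.count false)
    (h' : area s < area t) (r : List Bool) : area (r ++ s) < area (r ++ t) := by
  induction r with
  | nil => exact h'
  | cons a r ih => simp only [List.cons_append, area, List.count_cons, List.count_append]; omega

variable {n : ℕ} {lam : Par n}

/-! ### Spans of the elements attached to words -/

/-- The words that encode the paths to `lam`. -/
structure IsPath (lam : Par n) (s : List Bool) : Prop where
  ballot : Ballot s
  length : s.length = n
  dn_eq : dn s = lam.1.1

/-- The span of the elements attached to the paths with property `P`, modulo the paths to larger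
shapes. -/
def pathSpan (lam : Par n) (P : List Bool → Prop) : Submodule ℤ[X] (TL n) :=
  Submodule.span ℤ[X] (M n '' {s | IsPath lam s ∧ P s} ∪ {a | a ∈ idealCheck lam})

variable {P Q : List Bool → Prop}

theorem M_mem_pathSpan {s : List Bool} (hs : IsPath lam s) (h : P s) : M n s ∈ pathSpan lam P :=
  Submodule.subset_span (Or.inl ⟨s, ⟨hs, h⟩, rfl⟩)

theorem mem_pathSpan_of_mem_idealCheck {a : TL n} (h : a ∈ idealCheck lam) : a ∈ pathSpan lam P :=
  Submodule.subset_span (Or.inr h)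

theorem pathSpan_mono (h : ∀ s, P s → Q s) : pathSpan lam P ≤ pathSpan lam Q :=
  Submodule.span_mono (Set.union_subset_union_left _ (Set.image_mono fun s hs => ⟨hs.1, h s hs.2⟩))

theorem mul_mem_pathSpan {c y : TL n} (hy : y ∈ pathSpan lam P)
    (h : ∀ s, IsPath lam s → P s → M n s * c ∈ pathSpan lam Q) : y * c ∈ pathSpan lam Q := by
  have : pathSpan lam P ≤ (pathSpan lam Q).comap (LinearMap.mulRight ℤ[X] c) := by
    refine Submodule.span_le.2 ?_
    rintro a (⟨s, hs, rfl⟩ | ha)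
    · exact h s hs.1 hs.2
    · exact mem_pathSpan_of_mem_idealCheck ((idealCheck lam).mul_mem_right _ _ ha)
  exact this hy

/-- For j = 2f+1 the product is m_μ with μ the next larger partition; e_{j+1} = e_{j+1} e_j e_{j+1}
propagates this upwards. -/
theorem e_mul_oddProd_mem {f j : ℕ} (hf : f = lam.1.1) (h : 2 * f + 1 ≤ j) (hj : j < n) :
    e n j * oddProd n f ∈ idealCheck lam := by
  induction j, h using Nat.le_induction with
  | base =>
    have hle : idealLam (n := n) ⟨(f + 1, n - 2 * (f + 1)), by simp only; omega⟩ ≤ idealCheck lam := by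
      refine le_iSup₂_of_le _ ⟨?_, fun h => ?_⟩ le_rfl
      · simp [Par.Dom, hf]
      · have := congrArg (fun q : Par n => q.1.1) h
        simp [hf] at this
    rw [e_oddProd_commute le_rfl, ← oddProd_succ]
    exact hle (TwoSidedIdeal.subset_span rfl)
  | succ j h ih =>
    rw [← e_succ_braid (show 1 ≤ j by omega), mul_assoc, e_oddProd_commute (by omega), ← mul_assoc,
      mul_assoc (e n (j + 1))]
    exact (idealCheck lam).mul_mem_right _ _ ((idealCheck lam).mul_mem_left _ _ (ih (by omega)))

/-- Unless `s` has a valley there, a generator maps `M n s` to larger paths. -/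
theorem M_mul_e_mem {r q : List Bool} {a b : Bool} (hs : IsPath lam (r ++ b :: a :: q))
    (hab : ¬(a = true ∧ b = false)) :
    M n (r ++ b :: a :: q) * e n (q.length + 1)
      ∈ pathSpan lam (fun s => Dom s (r ++ b :: a :: q) ∧ (a = b → s ≠ r ++ b :: a :: q)) := by
  have hq : Ballot q := Ballot.of_append (r := r ++ [b, a]) (by simpa using hs.ballot)
  have hq2 := hq.two_mul_dn_le
  have hl := hs.length
  have hd := hs.dn_eq
  match a, b, hs, hab, hl, hd with
  | true, false, _, hab, _, _ => exact absurd ⟨rfl, rfl⟩ hab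
  | false, true, hs, _, _, _ =>
    rw [M_mul_e_peak hq]
    exact Submodule.smul_mem _ _ (M_mem_pathSpan hs ⟨Dom.refl _, by simp⟩)
  | false, false, hs, _, hl, hd =>
    -- Is the second opening closed later? If not, the generator moves left to m_λ and lands in the
    -- ideal; if so, the closing found here is its partner.
    rcases ballot_or_exists_eq r with hr | ⟨r', s₁, rfl, h₁, hb⟩
    · refine mem_pathSpan_of_mem_idealCheck ?_
      have hr2 := hr.two_mul_dn_le
      simp at hl hd
      rw [M_mul_e_open hq hr (by omega), M_eq hs.ballot, ← mul_assoc]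
      refine (idealCheck lam).mul_mem_right _ _ (e_mul_oddProd_mem hs.dn_eq ?_ ?_)
      · simp; omega
      · omega
    · simp only [List.append_assoc, List.cons_append] at hs hl hd ⊢
      rw [M_mul_e_up_up hq h₁ hb (by simp at hl; omega)]
      have hB : Ballot (false :: (s₁ ++ true :: false :: q)) :=
        (h₁.append (s := true :: false :: q) ⟨by simp; omega, hq.false_cons⟩).false_cons
      refine M_mem_pathSpan ⟨hs.ballot.append_congr hB (by simp; omega) (by simp), ?_, ?_⟩
        ⟨Dom.append_left ?_ _, by simp⟩
      · simpa using hl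
      · rw [← hd]; simp; omega
      · have : Dom (true :: false :: q) (false :: false :: q) := ⟨by simp, Dom.refl _⟩
        exact ⟨by simp, this.append_left s₁⟩
  | true, true, hs, _, hl, hd =>
    have hs2 : 2 * dn q + 2 ≤ q.length := by
      have := (Ballot.of_append hs.ballot).two_mul_dn_le
      simp at this
      omega
    -- The opening matched with the first of the two closings; it turns into a closing.
    obtain ⟨s₁, s₀, rfl, h₁, hb⟩ := exists_last_open q hq (by omega)
    have h₀ : Ballot s₀ := Ballot.of_append (r := s₁ ++ [false]) (by simpa using hq)
    simp at hs2
    rw [M_mul_e_down_down h₀ h₁ hb (by omega) (by simp at hl; omega)]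
    have hB : Ballot (s₁ ++ true :: s₀) := h₁.append ⟨by simp; omega, h₀⟩
    refine M_mem_pathSpan ⟨hs.ballot.append_congr
      (s' := true :: false :: (s₁ ++ true :: s₀)) ⟨by simp; omega, hB.false_cons⟩
        (by simp; omega) (by simp), ?_, ?_⟩ ⟨Dom.append_left ?_ _, by simp⟩
    · simpa using hl
    · rw [← hd]; simp; omega
    · have : Dom (true :: s₀) (false :: s₀) := ⟨by simp, Dom.refl _⟩
      exact ⟨by simp, by simp, this.append_left s₁⟩

theorem exists_eq_append_cons_cons {s : List Bool} {j : ℕ} (h : j + 2 ≤ s.length) :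
    ∃ r b a q, s = r ++ b :: a :: q ∧ q.length = j := by
  obtain ⟨m, hm⟩ := Nat.exists_eq_add_of_le h
  match hd : s.drop m with
  | [] => simp at hd; omega
  | [b] => have := congrArg List.length hd; simp at this; omega
  | b :: a :: q =>
    refine ⟨s.take m, b, a, q, by rw [← hd, List.take_append_drop], ?_⟩
    have := congrArg List.length hd
    simp at this
    omega

/-- How a generator moves the paths above `t`, according to the steps of `t` at that place. -/
theorem M_mul_e_mem_of_sDom {r' v v' q' s : List Bool} (hv : v.length = 2) (hv' : v'.length = 2)
    (hvv : dn v' = dn v)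
    (hs : IsPath lam s) (ht : IsPath lam (r' ++ (v ++ q')))
    (h : SDom s (r' ++ (v ++ q'))) (htt : Dom (r' ++ (v ++ q')) (r' ++ (v' ++ q')))
    (hval : ∀ q, Dom (false :: true :: q) (v ++ q') → Dom (true :: false :: q) (v' ++ q'))
    (hne : v = [false, true] ∨ v' ≠ [true, false]) :
    M n s * e n (q'.length + 1) ∈ pathSpan lam (fun s => SDom s (r' ++ (v' ++ q'))) := by
  have hl := ht.length
  simp [hv] at hl
  obtain ⟨r, b, a, q, rfl, hq⟩ := exists_eq_append_cons_cons (s := s) (j := q'.length)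
    (by rw [hs.length]; omega)
  have hrl : r.length = r'.length := by
    have := hs.length
    simp at this
    omega
  rw [← hq]
  by_cases hab : a = true ∧ b = false
  · obtain ⟨rfl, rfl⟩ := hab
    have hB := Ballot.of_append hs.ballot
    rw [M_mul_e_valley hB.2]
    have hD : Dom (r ++ true :: false :: q) (r' ++ (v' ++ q')) :=
      h.1.append_congr hrl (hval q (h.1.of_append hrl)) (by simp) (by simp [hvv])
    refine M_mem_pathSpan ⟨hs.ballot.append_congr (s' := true :: false :: q)
      ⟨?_, hB.2.2.false_cons⟩ (by simp) (by simp), ?_, ?_⟩ ⟨hD, ?_⟩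
    · have := hB.1; simpa using this
    · have := hs.length; simpa using this
    · have := hs.dn_eq; simpa using this
    · intro heq
      obtain ⟨rfl, heq'⟩ := List.append_inj heq hrl
      obtain ⟨h1, rfl⟩ := List.append_inj (s₁ := [true, false]) heq' (by simp [hv'])
      -- If `v` is the valley, equality would make the original path equal to the lower bound in
      -- `h`; otherwise `v'` is not a peak.
      rcases hne with rfl | hne
      · exact h.2 rfl
      · exact hne h1.symm
  · exact pathSpan_mono (fun s' hs' => (hs'.1.trans_sDom h).trans_dom htt) (M_mul_e_mem hs hab)

/-! ### Triangularity -/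

/-- The action of `z n k` on the paths to `lam` is triangular. -/
def Triangular (lam : Par n) (k : ℕ) : Prop :=
  ∀ r u, u.length = k → IsPath lam (r ++ u) →
    M n (r ++ u) * z n k - (p (dn u) * p (k - dn u + 1)) • M n (r ++ u)
      ∈ pathSpan lam (fun s => SDom s (r ++ u))

theorem Triangular.mul_mem {k : ℕ} (h : Triangular lam k) (hk : k ≤ n)
    (hP : ∀ s t, P t → Dom s t → P s) {y : TL n} (hy : y ∈ pathSpan lam P) :
    y * z n k ∈ pathSpan lam P := by
  refine mul_mem_pathSpan hy fun s hs hPs => ?_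
  have hs' : s.take (n - k) ++ s.drop (n - k) = s := List.take_append_drop _ _
  have := h (s.take (n - k)) (s.drop (n - k)) (by rw [List.length_drop, hs.length]; omega)
    (by rwa [hs'])
  rw [hs'] at this
  have h2 := add_mem (pathSpan_mono (fun s' (h' : SDom s' s) => hP _ _ hPs h'.1) this)
    (Submodule.smul_mem _ (p (dn (s.drop (n - k))) * p (k - dn (s.drop (n - k)) + 1))
      (M_mem_pathSpan hs hPs))
  simpa using h2

/-- Modulo strictly dominating paths every term with e_{k+1} dies, leaving x z_{k+1} - z_k; the
eigenvalues obey the same recursion through `p`. -/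
theorem triangular_step_of_up_up {k : ℕ} (h0 : Triangular lam k) (h1 : Triangular lam (k + 1))
    {r u : List Bool} (hu : u.length = k) (ht : IsPath lam (r ++ false :: false :: u)) :
    M n (r ++ false :: false :: u) * z n (k + 2)
        - (p (dn u) * p (k + 2 - dn u + 1)) • M n (r ++ false :: false :: u)
      ∈ pathSpan lam (fun s => SDom s (r ++ false :: false :: u)) := by
  set t := r ++ false :: false :: u with ht'
  have hl := ht.length
  have hq : Ballot u := Ballot.of_append (r := r ++ [false, false]) (by simpa [ht'] using ht.ballot)
  have hq2 := hq.two_mul_dn_le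
  simp [ht'] at hl
  have hP : ∀ s s', SDom s' t → Dom s s' → SDom s t := fun s s' h h' => h'.trans_sDom h
  have hE : M n t * e n (k + 1) ∈ pathSpan lam (fun s => SDom s t) := by
    have := M_mul_e_mem ht (by simp)
    rw [hu] at this
    exact pathSpan_mono (fun s hs => ⟨hs.1, hs.2 rfl⟩) this
  have hZ0 := h0 (r ++ [false, false]) u hu (by simpa [ht'] using ht)
  have hZ1 := h1 (r ++ [false]) (false :: u) (by simp [hu]) (by simpa [ht'] using ht)
  rw [show r ++ [false, false] ++ u = t by simp [ht']] at hZ0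
  rw [show r ++ [false] ++ false :: u = t by simp [ht'], dn_false] at hZ1
  have hZE := mul_mem_pathSpan (c := e n (k + 1)) hZ1 fun s hs hst => by
    have := M_mul_e_mem_of_sDom (r' := r) (v := [false, false]) (v' := [false, false]) (q' := u)
      rfl rfl rfl hs ht hst (Dom.refl _) (fun q hD => ⟨by have := hD.1; simpa using this,
        by have := hD.2.2.dn_le; simpa using this, hD.2.2⟩) (by simp)
    rw [hu] at this
    exact this
  have hEZ0 := h0.mul_mem (by omega) hP hE
  have hEZ1 := h1.mul_mem (by omega) hP hE
  have hp : p (dn u) * p (k + 2 - dn u + 1)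
      = X * (p (dn u) * p (k + 1 - dn u + 1)) - p (dn u) * p (k - dn u + 1) := by
    rw [show k + 2 - dn u + 1 = (k - dn u + 1) + 2 by omega,
      show k + 1 - dn u + 1 = k - dn u + 1 + 1 by omega, p_add_two]
    ring
  -- The coefficient of `hE` joins p_{k+1} from the recursion to minus the eigenvalue of z_{k+1},
  -- split off in the term M z_{k+1} e_{k+1}.
  have key := add_mem (sub_mem (add_mem (sub_mem (sub_mem (Submodule.smul_mem _ (X : ℤ[X]) hZ1) hZ0)
    hEZ1) (Submodule.smul_mem _ (X : ℤ[X]) hEZ0)) hZE)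
    (Submodule.smul_mem _ (p (k + 1) - p (dn u) * p (k + 1 - dn u + 1)) hE)
  convert key using 1
  rw [(zRec n k).recursion, hp]
  simp only [mul_sub, mul_add, mul_smul_comm, sub_mul, smul_mul_assoc, ← mul_assoc]
  module

theorem isPath_valley {r q : List Bool} (h : IsPath lam (r ++ true :: false :: q))
    (hq : 2 * dn q < q.length) : IsPath lam (r ++ false :: true :: q) := by
  have hq' : Ballot q := Ballot.of_append (r := r ++ [true, false]) (by simpa using h.ballot)
  refine ⟨h.ballot.append_congr (s' := false :: true :: q) ⟨?_, ?_, hq'⟩ (by simp) (by simp), ?_, ?_⟩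
  · simp; omega
  · simp; omega
  · have := h.length; simpa using this
  · have := h.dn_eq; simpa using this

/-- Multiply the formula for the valley by the generator: it commutes with z_k and takes paths above
the valley to paths above the peak. -/
theorem triangular_step_of_valley {k : ℕ} (hk : k ≤ n) {c : ℤ[X]} {r q : List Bool}
    (hqk : q.length + 2 ≤ k) (hq : 2 * dn q < q.length)
    (ht : IsPath lam (r ++ true :: false :: q))
    (h : M n (r ++ false :: true :: q) * z n k - c • M n (r ++ false :: true :: q)
      ∈ pathSpan lam (fun s => SDom s (r ++ false :: true :: q))) :
    M n (r ++ true :: false :: q) * z n k - c • M n (r ++ true :: false :: q)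
      ∈ pathSpan lam (fun s => SDom s (r ++ true :: false :: q)) := by
  have hv := isPath_valley ht hq
  have hB := Ballot.of_append hv.ballot
  have key := mul_mem_pathSpan (c := e n (q.length + 1)) h fun s hs hst =>
    M_mul_e_mem_of_sDom (r' := r) (v := [false, true]) (v' := [true, false]) (q' := q)
      rfl rfl rfl hs hv hst (sDom_valley_peak r q).1 (fun q' hD =>
        ⟨by have := hD.1; simpa using this, by have := hD.2.2.dn_le; simpa using this, hD.2.2⟩)
      (by simp)
  rw [sub_mul, smul_mul_assoc, mul_assoc, ← e_z_commute hk (by omega), ← mul_assoc,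
    M_mul_e_valley hB.2] at key
  exact key

theorem triangular_step_of_zigzag {k i d : ℕ} (hk : k ≤ n) (hd : d < 2) {r : List Bool}
    (hl : (List.replicate d false ++ zigzag i).length = k) :
    M n (r ++ (List.replicate d false ++ zigzag i)) * z n k
      = (p i * p (k - i + 1)) • M n (r ++ (List.replicate d false ++ zigzag i)) := by
  rw [M_append, mul_assoc, ← mul_smul_comm]
  congr 1
  simp at hl
  interval_cases d
  · simp only [List.replicate_zero, List.nil_append, M_zigzag]
    rw [← hl, show 0 + 2 * i - i + 1 = i + 1 by omega, zero_add]
    exact oddProd_mul_z_even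
  · simp only [List.replicate_one, List.singleton_append, M, M_zigzag]
    rw [← hl, show 1 + 2 * i - i + 1 = i + 2 by omega, add_comm 1]
    exact oddProd_mul_z_odd (by omega)

theorem triangular (lam : Par n) {k : ℕ} (hk : k ≤ n) : Triangular lam k := by
  induction k using Nat.strong_induction_on with
  | _ k ih =>
    intro r u hu ht
    induction ha : area u using Nat.strong_induction_on generalizing u with
    | _ A ihA =>
      subst ha
      rcases exists_peak_or_eq u ht.ballot.of_append with ⟨u₁, u₀, rfl, h₀⟩ | ⟨d, i, rfl⟩
      · simp at hu
        have ht' : IsPath lam ((r ++ u₁) ++ true :: false :: u₀) := by simpa using ht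
        have := ihA (area (u₁ ++ false :: true :: u₀))
          (area_append_lt (by simp) (by simp [area]) u₁) (u₁ ++ false :: true :: u₀)
          (by simpa using hu) (by simpa using isPath_valley ht' h₀) rfl
        rw [← List.append_assoc] at this ⊢
        have hd : dn (u₁ ++ false :: true :: u₀) = dn (u₁ ++ true :: false :: u₀) := by simp
        rw [hd] at this
        exact triangular_step_of_valley hk (by omega) h₀ ht' this
      · match d with
        | 0 =>
          rw [triangular_step_of_zigzag hk (by omega) hu]
          simp
        | 1 =>
          rw [triangular_step_of_zigzag hk (by omega) hu]
          simp
        | d + 2 =>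
          obtain ⟨k, rfl⟩ : ∃ m, k = m + 2 := ⟨d + 2 * i, by simp at hu; omega⟩
          exact triangular_step_of_up_up (ih k (by omega) (by omega))
            (ih (k + 1) (by omega) (by omega)) (u := List.replicate d false ++ zigzag i)
            (by simp at hu ⊢; omega) ht

/-! ### Tableaux and words -/

/-- The word of the restriction of `t` to its first `k` steps. -/
def Tab.word (t : Tab lam) : (k : ℕ) → k ≤ n → List Bool
  | 0, _ => []
  | k + 1, hk => decide ((t.shape k (by omega)).1.1 ≠ (t.shape (k + 1) hk).1.1) ::
      t.word k (by omega)

@[simp] theorem Tab.length_word (t : Tab lam) (k : ℕ) (hk : k ≤ n) : (t.word k hk).length = k := by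
  induction k with
  | zero => rfl
  | succ k ih => simp [Tab.word, ih]

theorem Tab.shape_zero (t : Tab lam) : (t.shape 0 (by omega)).1.1 = 0 := by
  have := (t.shape 0 (by omega)).2
  omega

theorem Tab.arrow (t : Tab lam) (k : ℕ) (hk : k + 1 ≤ n) :
    Par.Arrow (t.shape k (by omega)) (t.shape (k + 1) hk) :=
  t.2.2.1 ⟨k, hk⟩

theorem Tab.dn_word (t : Tab lam) (k : ℕ) (hk : k ≤ n) :
    dn (t.word k hk) = (t.shape k hk).1.1 := by
  induction k with
  | zero => rw [t.shape_zero]; rfl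
  | succ k ih =>
    have ih := ih (by omega)
    rcases t.arrow k hk with ⟨h, -⟩ | ⟨h, -⟩
    · simp [Tab.word, h, ih]
    · rw [Tab.word, decide_eq_true (by omega), dn_true, ih, h]

theorem Tab.ballot_word (t : Tab lam) (k : ℕ) (hk : k ≤ n) : Ballot (t.word k hk) := by
  induction k with
  | zero => trivial
  | succ k ih =>
    refine ⟨?_, ih (by omega)⟩
    have := t.dn_word (k + 1) hk
    rw [Tab.word] at this
    rw [this, t.length_word]
    have := (t.shape (k + 1) hk).2
    omega

theorem Tab.isPath_word (t : Tab lam) : IsPath lam (t.word n le_rfl) :=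
  ⟨t.ballot_word n le_rfl, t.length_word n le_rfl, by
    rw [t.dn_word]; exact congrArg (fun q : Par n => q.1.1) t.2.2.2⟩

theorem Tab.drop_word (t : Tab lam) (j k : ℕ) (hk : j + k ≤ n) :
    (t.word (j + k) hk).drop j = t.word k (by omega) := by
  induction j with
  | zero => simp
  | succ j ih =>
    -- The length is generalized because `j + 1 + k` does not reduce to a successor.
    have h : ∀ l (hl : l ≤ n), l = j + 1 + k → (t.word l hl).drop (j + 1) = t.word k (by omega) := by
      rintro l hl h
      obtain rfl : l = j + k + 1 := by omega
      exact ih (by omega)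
    exact h _ _ rfl

theorem Tab.vWord_word (t : Tab lam) (k : ℕ) (hk : k ≤ n) : vWord n (t.word k hk) = t.vRestr k hk := by
  induction k with
  | zero => rfl
  | succ k ih =>
    have ih := ih (by omega)
    rw [Tab.word, Tab.vRestr]
    split_ifs with h
    · rw [decide_eq_false (by simpa using h), vWord, ih]
    · rw [decide_eq_true h, vWord, ih, t.dn_word, t.length_word]
      rcases t.arrow k hk with ⟨h', -⟩ | ⟨h', -⟩
      · exact absurd h' h
      · rw [← h', mul_add]

theorem Tab.M_word (t : Tab lam) : M n (t.word n le_rfl) = mLam lam * t.v := by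
  rw [M_eq t.isPath_word.ballot, t.vWord_word, t.isPath_word.dn_eq]
  rfl

theorem Ballot.drop {s : List Bool} (h : Ballot s) (k : ℕ) : Ballot (s.drop k) :=
  Ballot.of_append (r := s.take k) (by rwa [List.take_append_drop])

/-- The path encoded by a word. -/
def Tab.ofWord {s : List Bool} (hs : IsPath lam s) : Tab lam :=
  ⟨fun k => ⟨(dn (s.drop (n - k)), k - 2 * dn (s.drop (n - k))), by
      have := (hs.ballot.drop (n - k)).two_mul_dn_le
      rw [List.length_drop, hs.length] at this
      simp only
      omega⟩, by
    refine ⟨?_, fun k => ?_, ?_⟩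
    · have h : s.drop n = [] := by rw [List.drop_eq_nil_iff, hs.length]
      simp [h]
    · have hlt : n - (k + 1) < s.length := by rw [hs.length]; omega
      have hd := List.drop_eq_getElem_cons hlt
      rw [show n - (k + 1) + 1 = n - k by omega] at hd
      have h2 := (hs.ballot.drop (n - (k + 1))).two_mul_dn_le
      rw [List.length_drop, hs.length] at h2
      have h3 := (hs.ballot.drop (n - k)).two_mul_dn_le
      rw [List.length_drop, hs.length] at h3
      have hk := k.2
      simp only [Par.Arrow, Fin.val_castSucc, Fin.val_succ]
      rcases hb : s[n - (k + 1)] with _ | _ <;> rw [hb] at hd <;> rw [hd] at h2 ⊢ <;>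
        simp only [dn_true, dn_false] at h2 ⊢
      · exact Or.inl ⟨trivial, by omega⟩
      · exact Or.inr ⟨trivial, by omega⟩
    · have := lam.2
      have := hs.dn_eq
      refine Subtype.ext (Prod.ext ?_ ?_)
      · simpa using this
      · simp; omega⟩

theorem Tab.word_ofWord {s : List Bool} (hs : IsPath lam s) (k : ℕ) (hk : k ≤ n) :
    (Tab.ofWord hs).word k hk = s.drop (n - k) := by
  induction k with
  | zero =>
    rw [Tab.word, eq_comm, List.drop_eq_nil_iff, hs.length]
    omega
  | succ k ih =>
    have hlt : n - (k + 1) < s.length := by rw [hs.length]; omega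
    have hd := List.drop_eq_getElem_cons hlt
    rw [show n - (k + 1) + 1 = n - k by omega] at hd
    rw [Tab.word, ih (by omega), hd]
    congr 1
    change decide (dn (s.drop (n - k)) ≠ dn (s.drop (n - (k + 1)))) = _
    rw [hd]
    cases s[n - (k + 1)] <;> simp

theorem Dom.drop {s t : List Bool} (h : Dom s t) (k : ℕ) : Dom (s.drop k) (t.drop k) := by
  induction k generalizing s t with
  | zero => exact h
  | succ k ih =>
    cases s <;> cases t
    · trivial
    · exact h.elim
    · exact h.elim
    · exact ih h.2

theorem Tab.dom_of_word {s t : Tab lam}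
    (h : TemperleyLieb.Dom (s.word n le_rfl) (t.word n le_rfl)) : s.Dom t := by
  intro k hk
  have := (h.drop (n - k)).dn_le
  have hd : ∀ u : Tab lam, (u.word n le_rfl).drop (n - k) = u.word k hk := by
    intro u
    have h : ∀ l (hl : l ≤ n), l = (n - k) + k → (u.word l hl).drop (n - k) = u.word k hk := by
      rintro l hl rfl
      exact u.drop_word _ _ _
    exact h _ _ (by omega)
  rw [hd, hd, dn_word, dn_word] at this
  exact this

/-! ### The eigenvalues -/

theorem Tab.z_zero (t : Tab lam) : t.z 0 (by omega) = 0 := by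
  simp [Tab.z, Tab.r]

theorem Tab.z_succ (t : Tab lam) (k : ℕ) (hk : k + 1 ≤ n) :
    t.z (k + 1) hk = t.r (k + 1) hk + X * t.z k (by omega) := by
  rw [Tab.z, Fin.sum_univ_succ, Tab.z, Finset.mul_sum]
  congr 1
  · simp
  · refine Finset.sum_congr rfl fun l _ => ?_
    simp only [Fin.val_succ, pow_succ', Nat.add_sub_add_right, mul_assoc]

/-- For either kind of step, r_t(k) is the new product minus x times the old one. -/
theorem Tab.z_eq (t : Tab lam) (k : ℕ) (hk : k ≤ n) :
    t.z k hk = p (t.shape k hk).1.1 * p (k - (t.shape k hk).1.1 + 1) := by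
  induction k with
  | zero => rw [t.z_zero, t.shape_zero]; simp
  | succ k ih =>
    rw [t.z_succ, ih (by omega)]
    match k, hk with
    | 0, hk =>
      have h1 : (t.shape 1 hk).1.1 = 0 := by have := (t.shape 1 hk).2; omega
      rw [t.shape_zero, h1]
      simp [Tab.r]
    | k + 1, hk =>
      have h1 := (t.shape (k + 1) (by omega)).2
      have h2 := (t.shape (k + 2) hk).2
      have ht : Par.Arrow (t.shape (k + 1) (by omega)) (t.shape (k + 2) hk) := t.arrow (k + 1) hk
      change _ = p (t.shape (k + 2) hk).1.1 * p (k + 2 - (t.shape (k + 2) hk).1.1 + 1)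
      simp only [Tab.r]
      rcases ht with ⟨h, -⟩ | ⟨h, -⟩
      · rw [if_neg (by omega), ← h, show k + 2 - (t.shape (k + 1) (by omega)).1.1
          = k + 1 - (t.shape (k + 1) (by omega)).1.1 + 1 by omega]
        ring
      · rw [if_pos h, ← h, Nat.add_sub_cancel, show k + 2 - ((t.shape (k + 1) (by omega)).1.1 + 1)
          = k + 1 - (t.shape (k + 1) (by omega)).1.1 by omega]
        ring

/-! ### The cell module -/

/-- The quotient map, with scalars restricted to `ℤ[X]`. -/
def quoMap (lam : Par n) : TL n →ₗ[ℤ[X]] Quo lam :=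
  (rightSubmodule (idealCheck lam)).mkQ.restrictScalars ℤ[X]

theorem quoMap_eq_zero {a : TL n} (h : a ∈ idealCheck lam) : quoMap lam a = 0 :=
  (Submodule.Quotient.mk_eq_zero _).2 h

theorem Tab.coe_m (t : Tab lam) : (t.m : Quo lam) = quoMap lam (M n (t.word n le_rfl)) := by
  rw [t.M_word]
  rfl

open Classical in
theorem exists_sum_of_mem_pathSpan (t : Tab lam) {y : TL n}
    (hy : y ∈ pathSpan lam (fun s => TemperleyLieb.SDom s (t.word n le_rfl))) :
    ∃ a : Tab lam → ℤ[X], quoMap lam y =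
      ((∑ s ∈ Finset.univ.filter (fun s : Tab lam => s.SDom t), a s • s.m : cell lam) : Quo lam) := by
  induction hy using Submodule.span_induction with
  | zero => exact ⟨0, by simp⟩
  | add x y _ _ hx hy =>
    obtain ⟨a, ha⟩ := hx
    obtain ⟨b, hb⟩ := hy
    refine ⟨a + b, ?_⟩
    rw [map_add, ha, hb, ← Submodule.coe_add, ← Finset.sum_add_distrib]
    simp only [Pi.add_apply, add_smul]
  | smul c x _ hx =>
    obtain ⟨a, ha⟩ := hx
    refine ⟨c • a, ?_⟩
    rw [map_smul, ha, ← Submodule.coe_smul_of_tower, Finset.smul_sum]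
    simp only [Pi.smul_apply, smul_smul, smul_eq_mul]
  | mem x hx =>
    rcases hx with ⟨s, ⟨hs, hst⟩, rfl⟩ | hx
    · have hw : (Tab.ofWord hs).word n le_rfl = s := by simp [Tab.word_ofWord]
      have hS : (Tab.ofWord hs).SDom t :=
        ⟨Tab.dom_of_word (by rw [hw]; exact hst.1), fun h => hst.2 (by rw [← h, hw])⟩
      refine ⟨Pi.single (Tab.ofWord hs) 1, ?_⟩
      rw [Finset.sum_eq_single_of_mem (Tab.ofWord hs) (by simpa using hS)
        (fun b _ hb => by rw [Pi.single_eq_of_ne hb, zero_smul])]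
      rw [Pi.single_eq_same, one_smul, Tab.coe_m, hw]
    · exact ⟨0, by simp [quoMap_eq_zero hx]⟩

end TemperleyLieb

end

open TemperleyLieb in
open Classical in
theorem mainTheorem4 (n : ℕ) (lam : Par n) (t : Tab lam) (k i : ℕ) (hk : k ≤ n)
    (hshape : (t.shape k hk).1 = (i, k - 2 * i)) :
    (z n k ∈ tower n k ∧ ∀ a ∈ tower n k, z n k * a = a * z n k) ∧
    t.z k hk = p i * p (k - i + 1) ∧
    ∃ a : Tab lam → Polynomial ℤ,
      MulOpposite.op (z n k) • t.m =
        t.z k hk • t.m + ∑ s ∈ Finset.univ.filter (fun s : Tab lam => s.SDom t), a s • s.m := by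
  have hi : (t.shape k hk).1.1 = i := by rw [hshape]
  have hz : t.z k hk = p i * p (k - i + 1) := by rw [t.z_eq, hi]
  refine ⟨⟨z_mem_tower n k, fun a ha => z_central hk ha⟩, hz, ?_⟩
  -- The last `l` steps are the head of the word, the first `k` its tail.
  obtain ⟨l, rfl⟩ : ∃ l, n = l + k := ⟨n - k, by omega⟩
  have hw : (t.word (l + k) le_rfl).take l ++ t.word k hk = t.word (l + k) le_rfl := by
    rw [← t.drop_word l k le_rfl, List.take_append_drop]
  have h := triangular lam hk ((t.word (l + k) le_rfl).take l) (t.word k hk) (t.length_word k hk)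
    (by rw [hw]; exact t.isPath_word)
  rw [hw, t.dn_word, hi, ← hz] at h
  obtain ⟨a, ha⟩ := exists_sum_of_mem_pathSpan t h
  refine ⟨a, Subtype.ext ?_⟩
  rw [Submodule.coe_add, ← ha, map_sub, map_smul, ← t.coe_m, Submodule.coe_smul_of_tower (t.z k hk)]
  rw [add_sub_cancel, Submodule.coe_smul, t.coe_m]
  rfl
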